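/- Let $\mathbb F_A$ be a free group of finite rank and $A=A^{-1}$ the symmetric set consisting of a set of free generators and their inverses; $|x|$ denotes the length of the reduced word of $x\in\mathbb F_A$. A matrix system $(V_a,H_{ba})$ consists of finite dimensional complex vector spaces $V_a$ ($a\in A$) and linear maps $H_{ba}:V_a\to V_b$ ($a,b\in A$) with $H_{ba}=0$ whenever $ab=e$. An invariant subsystem is a tuple of subspaces $W_a\subseteq V_a$ with $H_{ba}W_a\subseteq W_b$ for all $a,b$. The system is irreducible if it is nonzero and its only invariant subsystems are $(0)$ and $(V_a)$. It is a matrix system with inner products $(V_a,H_{ba},B_a)$ if it is equipped with positive semi-definite Hermitian sesquilinear forms $B_a$ on $V_a$ such that $$B_a(v,v)=\sum_{b\in A}B_b(H_{ba}v,H_{ba}v)\qquad(a\in A,\ v\in V_a).$$ A multiplicative function is a function $f:\mathbb F_A\to\coprod_a V_a$ for which there is $N\ge 0$ such that for every $x$ with $|x|\ge N$ whose reduced word ends with $a\in A$, one has $f(x)\in V_a$ and $f(xb)=H_{ba}f(x)$ for all $b\in A$ with $|xb|=|x|+1$. Let $\mathcal H^\infty$ be the vector space of multiplicative functions modulo equality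 at all but finitely many elements, with $$\langle f,g\rangle=\sum_{|x|=N}\ \sum_{a\in A,\ |xa|=|x|+1}B_a\big(f(xa),g(xa)\big),\qquad N \text{ large enough for both } f \text{ and } g$$ (this does not depend on $N$). Let $\mathcal H(V_a,H_{ba},B_a)$ be the Hilbert space obtained by (separating and) completing $\mathcal H^\infty$, and let $\pi$ be the unitary representation of $\mathbb F_A$ on it which extends $(\pi(x)f)(y)=f(x^{-1}y)$. It is called the representation constructed from $(V_a,H_{ba},B_a)$. **Theorem.** For every matrix system with inner products $(V_a,H_{ba},B_a)$, not necessarily irreducible, the representation $\pi$ on $\mathcal H=\mathcal H(V_a,H_{ba},B_a)$ is an orthogonal direct sum, with respect to the inner product of $\mathcal H$ defined by $\mathcal B=(B_a)$, of finitely many representations constructed from irreducible matrix systems. That is, there are an integer $n\ge 0$, pairwise orthogonal closed $\pi$-invariant subspaces $K_1,\dots,K_n$ of $\mathcal H$ with $\mathcal H=K_1\oplus\dots\oplus K_n$, and irreducible matrix systems with strictly positive definite inner products $(V^i_a,H^i_{ba},B^i_a)$, $1\le i\le n$, such that for each $i$ the restriction of $\pi$ to $K_i$ is unitarily equivalent to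 the representation constructed from $(V^i_a,H^i_{ba},B^i_a)$. -/

import Mathlib

open scoped ComplexConjugate

universe u v

namespace MultRep

section Words

variable {S : Type*}

/-- The element of the free group given by the letter `a = (s, ε)`. -/
def letter (a : S × Bool) : FreeGroup S := FreeGroup.mk [a]

/-- Every property of group elements which holds for the letters and is stable under products
holds everywhere. -/
theorem letter_induction {p : FreeGroup S → Prop} (h1 : p 1) (hl : ∀ a, p (letter a))
    (hm : ∀ x y, p x → p y → p (x * y)) (x : FreeGroup S) : p x := by
  induction x using FreeGroup.induction_on with
  | C1 => exact h1
  | of s => exact hl (s, true)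
  | inv_of s _ => exact hl (s, false)
  | mul x y hx hy => exact hm x y hx hy

variable [DecidableEq S]

/-- `x ∈ E(a)`: the reduced word of `x` ends with the letter `a`. -/
def EndsWith (x : FreeGroup S) (a : S × Bool) : Prop := x.toWord.getLast? = some a

theorem toWord_letter (a : S × Bool) : (letter a).toWord = [a] := rfl

theorem letter_mul_letter_eq_one {a b : S × Bool} :
    letter a * letter b = 1 ↔ a.1 = b.1 ∧ a.2 = !b.2 := by
  rw [← FreeGroup.toWord_eq_nil_iff, FreeGroup.toWord_mul, toWord_letter, toWord_letter]
  simp only [List.cons_append, List.nil_append, FreeGroup.reduce.cons, FreeGroup.reduce_nil]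
  split_ifs <;> simp_all

theorem toWord_mul_letter {x : FreeGroup S} {a b : S × Bool} (hx : EndsWith x a)
    (h : letter a * letter b ≠ 1) : (x * letter b).toWord = x.toWord ++ [b] := by
  rw [FreeGroup.toWord_mul, toWord_letter]
  apply FreeGroup.IsReduced.reduce_eq
  have hr : FreeGroup.IsReduced x.toWord := FreeGroup.isReduced_toWord
  rw [FreeGroup.IsReduced] at hr ⊢
  rw [List.isChain_append]
  refine ⟨hr, List.isChain_singleton _, ?_⟩
  intro c hc d hd
  rw [EndsWith] at hx
  rw [hx] at hc
  simp at hc hd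
  subst hc hd
  rw [Ne, letter_mul_letter_eq_one] at h
  intro h1
  by_contra h2
  exact h ⟨h1, by simpa [Bool.eq_not] using h2⟩

theorem norm_mul_letter_of_cancel {x : FreeGroup S} {a b : S × Bool} (hx : EndsWith x a)
    (h : letter a * letter b = 1) : (x * letter b).norm + 1 = x.norm := by
  obtain ⟨l, hl⟩ := List.getLast?_eq_some_iff.1 hx
  have hx' : x = FreeGroup.mk l * letter a := by
    rw [letter, FreeGroup.mul_mk, ← hl, FreeGroup.mk_toWord]
  have hr : FreeGroup.IsReduced (l ++ [a]) := hl ▸ FreeGroup.isReduced_toWord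
  have hr' : FreeGroup.IsReduced l := (List.isChain_append.1 hr).1
  rw [FreeGroup.norm, FreeGroup.norm, hl, hx', mul_assoc, h, mul_one, FreeGroup.toWord_mk,
    hr'.reduce_eq]
  simp

theorem norm_mul_letter_iff {x : FreeGroup S} {a b : S × Bool} (hx : EndsWith x a) :
    (x * letter b).norm = x.norm + 1 ↔ letter a * letter b ≠ 1 := by
  constructor
  · intro h h'
    have := norm_mul_letter_of_cancel hx h'
    omega
  · intro h
    rw [FreeGroup.norm, toWord_mul_letter hx h]
    simp [FreeGroup.norm]

theorem exists_endsWith {x : FreeGroup S} (hx : x.norm ≠ 0) : ∃ a, EndsWith x a := by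
  have h : x.toWord ≠ [] := fun h => hx (by simp [FreeGroup.norm, h])
  exact ⟨_, List.getLast?_eq_some_getLast h⟩

theorem EndsWith.unique {x : FreeGroup S} {a b : S × Bool} (ha : EndsWith x a)
    (hb : EndsWith x b) : a = b := by
  rw [EndsWith] at ha hb
  simpa [ha] using hb

theorem EndsWith.norm_ne_zero {x : FreeGroup S} {a : S × Bool} (ha : EndsWith x a) :
    x.norm ≠ 0 := by
  intro h
  rw [FreeGroup.norm_eq_zero] at h
  subst h
  simp [EndsWith] at ha

theorem toWord_mul_letter_of_norm {x : FreeGroup S} {b : S × Bool}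
    (h : (x * letter b).norm = x.norm + 1) : (x * letter b).toWord = x.toWord ++ [b] := by
  by_cases hx : x.norm = 0
  · rw [FreeGroup.norm_eq_zero] at hx
    subst hx
    simp [toWord_letter]
  · obtain ⟨a, ha⟩ := exists_endsWith hx
    exact toWord_mul_letter ha ((norm_mul_letter_iff ha).1 h)

theorem endsWith_mul_letter {x : FreeGroup S} {b : S × Bool}
    (h : (x * letter b).norm = x.norm + 1) : EndsWith (x * letter b) b := by
  rw [EndsWith, toWord_mul_letter_of_norm h]
  simp

theorem exists_eq_mul_letter {y : FreeGroup S} {n : ℕ} (hy : y.norm = n + 1) :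
    ∃ x : FreeGroup S, ∃ b : S × Bool, x.norm = n ∧ y = x * letter b := by
  obtain ⟨b, hb⟩ := exists_endsWith (x := y) (by omega)
  obtain ⟨l, hl⟩ := List.getLast?_eq_some_iff.1 hb
  have hr : FreeGroup.IsReduced (l ++ [b]) := hl ▸ FreeGroup.isReduced_toWord
  have hr' : FreeGroup.IsReduced l := (List.isChain_append.1 hr).1
  refine ⟨FreeGroup.mk l, b, ?_, ?_⟩
  · rw [FreeGroup.norm, FreeGroup.toWord_mk, hr'.reduce_eq]
    rw [FreeGroup.norm, hl] at hy
    simpa using hy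
  · rw [letter, FreeGroup.mul_mk, ← hl, FreeGroup.mk_toWord]

theorem toWord_letter_mul (s : S × Bool) (y : FreeGroup S) :
    (y.toWord = [] ∧ (letter s * y).toWord = [s]) ∨
    (∃ c t, y.toWord = c :: t ∧
      (letter s * y).toWord = if s.1 = c.1 ∧ s.2 = !c.2 then t else s :: c :: t) := by
  have h : (letter s * y).toWord = FreeGroup.reduce (s :: y.toWord) := by
    rw [FreeGroup.toWord_mul, toWord_letter]; rfl
  rw [h, FreeGroup.reduce.cons, FreeGroup.reduce_toWord]
  cases hy : y.toWord with
  | nil => left; simp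
  | cons c t => right; exact ⟨c, t, rfl, rfl⟩

theorem norm_letter_mul (s : S × Bool) (y : FreeGroup S) :
    (letter s * y).norm = y.norm + 1 ∨ (letter s * y).norm + 1 = y.norm := by
  simp only [FreeGroup.norm]
  rcases toWord_letter_mul s y with ⟨h1, h2⟩ | ⟨c, t, h1, h2⟩
  · simp [h1, h2]
  · rw [h1, h2]
    split_ifs <;> simp

theorem norm_letter_mul_mul_letter {s b : S × Bool} {z : FreeGroup S} (hz : z.norm ≠ 0)
    (h : (z * letter b).norm = z.norm + 1) :
    (letter s * (z * letter b)).norm + 1 = (z * letter b).norm ↔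
      (letter s * z).norm + 1 = z.norm := by
  have hw := toWord_mul_letter_of_norm h
  simp only [FreeGroup.norm] at hz ⊢
  rcases toWord_letter_mul s z with ⟨h1, h2⟩ | ⟨c, t, h1, h2⟩
  · simp [h1] at hz
  · rcases toWord_letter_mul s (z * letter b) with ⟨h3, h4⟩ | ⟨c', t', h3, h4⟩
    · rw [h1] at hw; simp [hw] at h3
    · rw [hw, h1] at h3
      simp only [List.cons_append, List.cons.injEq] at h3
      obtain ⟨rfl, rfl⟩ := h3
      rw [h2, h4, hw, h1]
      split_ifs <;> simp

theorem endsWith_letter_mul {s a : S × Bool} {z : FreeGroup S} (hz : 2 ≤ z.norm) :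
    EndsWith (letter s * z) a ↔ EndsWith z a := by
  simp only [EndsWith]
  simp only [FreeGroup.norm] at hz
  rcases toWord_letter_mul s z with ⟨h1, h2⟩ | ⟨c, t, h1, h2⟩
  · simp [h1] at hz
  · rw [h2, h1]
    cases t with
    | nil => simp [h1] at hz
    | cons d t => split_ifs <;> simp [List.getLast?_cons]

theorem norm_letter_mul_mul_letter_iff {s b : S × Bool} {z : FreeGroup S} (hz : 2 ≤ z.norm) :
    (letter s * z * letter b).norm = (letter s * z).norm + 1 ↔
      (z * letter b).norm = z.norm + 1 := by
  obtain ⟨a, ha⟩ := exists_endsWith (x := z) (by omega)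
  rw [norm_mul_letter_iff ha, norm_mul_letter_iff ((endsWith_letter_mul hz).2 ha)]

variable [Fintype S]

theorem finite_norm_eq (n : ℕ) : {x : FreeGroup S | x.norm = n}.Finite :=
  (List.finite_length_eq (S × Bool) n).preimage FreeGroup.toWord_injective.injOn

/-- The sphere `{x : |x| = n}` of the Cayley graph. -/
noncomputable def sphere (S : Type*) [DecidableEq S] [Fintype S] (n : ℕ) :
    Finset (FreeGroup S) := (finite_norm_eq n).toFinset

theorem mem_sphere {n : ℕ} {x : FreeGroup S} : x ∈ sphere S n ↔ x.norm = n := by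
  simp [sphere]

theorem sum_sphere_succ (w : FreeGroup S → ℂ) (n : ℕ) (P : FreeGroup S → Prop)
    [DecidablePred P] :
    ∑ x ∈ sphere S n, ∑ a with (x * letter a).norm = x.norm + 1 ∧ P (x * letter a),
      w (x * letter a) = ∑ y ∈ sphere S (n + 1) with P y, w y := by
  rw [Finset.sum_sigma']
  refine Finset.sum_bij (fun p _ => p.1 * letter p.2) ?_ ?_ ?_ ?_
  · rintro ⟨x, a⟩ h
    simp only [Finset.mem_sigma, mem_sphere, Finset.mem_filter, Finset.mem_univ, true_and] at h ⊢
    exact ⟨by omega, h.2.2⟩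
  · rintro ⟨x, a⟩ h ⟨x', a'⟩ h' heq
    simp only [Finset.mem_sigma, Finset.mem_filter, Finset.mem_univ, true_and] at h h' heq
    have h3 := toWord_mul_letter_of_norm h.2.1
    have h4 := toWord_mul_letter_of_norm h'.2.1
    rw [heq, h4] at h3
    obtain ⟨h5, h6⟩ := List.append_inj_left' h3 rfl, List.append_inj_right' h3 rfl
    have h5' := FreeGroup.toWord_injective h5
    simp only [List.cons.injEq, and_true] at h6
    subst h5' h6
    rfl
  · intro y hy
    simp only [Finset.mem_filter, mem_sphere] at hy
    obtain ⟨x, b, hx, rfl⟩ := exists_eq_mul_letter hy.1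
    refine ⟨⟨x, b⟩, ?_, rfl⟩
    simp only [Finset.mem_sigma, mem_sphere, Finset.mem_filter, Finset.mem_univ, true_and]
    exact ⟨hx, by omega, hy.2⟩
  · intros; rfl

/-- A weight whose value at `x` is the sum of its values at the successors of `x` has the same
sums over all large spheres and over their left translates. -/
theorem sum_sphere_translate (w : FreeGroup S → ℂ) (N : ℕ)
    (hw : ∀ y : FreeGroup S, N ≤ y.norm → y.norm ≠ 0 →
      ∑ b with (y * letter b).norm = y.norm + 1, w (y * letter b) = w y)
    (s : S × Bool) (m : ℕ) (hm : N + 2 ≤ m) :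
    ∑ y ∈ sphere S m, w ((letter s)⁻¹ * y) = ∑ y ∈ sphere S m, w y := by
  classical
  have step : ∀ (P : FreeGroup S → Prop) [DecidablePred P] (n : ℕ), N ≤ n → n ≠ 0 →
      (∀ z b, z.norm ≠ 0 → (z * letter b).norm = z.norm + 1 → (P (z * letter b) ↔ P z)) →
      ∑ y ∈ sphere S (n + 1) with P y, w y = ∑ y ∈ sphere S n with P y, w y := by
    intro P _ n hn hn0 hP
    rw [← sum_sphere_succ, Finset.sum_filter]
    refine Finset.sum_congr rfl fun x hx => ?_
    rw [mem_sphere] at hx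
    split_ifs with hPx
    · rw [← hw x (by omega) (by omega)]
      refine Finset.sum_congr (Finset.filter_congr fun b _ => ?_) fun _ _ => rfl
      exact ⟨fun h => h.1, fun h => ⟨h, (hP x b (by omega) h).2 hPx⟩⟩
    · refine Finset.sum_eq_zero fun b hb => ?_
      simp only [Finset.mem_filter, Finset.mem_univ, true_and] at hb
      exact absurd ((hP x b (by omega) hb.1).1 hb.2) hPx
  obtain ⟨P, hPdef⟩ : ∃ P : FreeGroup S → Prop, P = fun z => (letter s * z).norm + 1 = z.norm :=
    ⟨_, rfl⟩
  have hP : ∀ z b, z.norm ≠ 0 → (z * letter b).norm = z.norm + 1 → (P (z * letter b) ↔ P z) :=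
    fun z b hz hzb => by
      simpa only [hPdef] using norm_letter_mul_mul_letter hz hzb
  obtain ⟨k, rfl⟩ : ∃ k, m = k + 1 := ⟨m - 1, by omega⟩
  have e1 := step P (k + 1) (by omega) (by omega) hP
  have e2 := step (fun z => ¬ P z) k (by omega) (by omega)
    (fun z b hz hzb => not_congr (hP z b hz hzb))
  have e3 : ∑ y ∈ sphere S (k + 1), w y =
      ∑ y ∈ sphere S (k + 1 + 1) with P y, w y + ∑ y ∈ sphere S k with ¬ P y, w y := by
    rw [e1, ← e2, ← Finset.sum_filter_add_sum_filter_not (sphere S (k + 1)) P w]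
  rw [e3,
    ← Finset.sum_filter_add_sum_filter_not (sphere S (k + 1))
      (fun y => P ((letter s)⁻¹ * y)) (fun y => w ((letter s)⁻¹ * y))]
  have key : ∀ (Q : FreeGroup S → Prop) [DecidablePred Q] (j : ℕ),
      (∀ z, Q z → ((letter s * z).norm = k + 1 ↔ z.norm = j)) →
      ∑ y ∈ sphere S (k + 1) with Q ((letter s)⁻¹ * y), w ((letter s)⁻¹ * y) =
        ∑ z ∈ sphere S j with Q z, w z := by
    intro Q _ j hQ
    refine Finset.sum_bij (fun y _ => (letter s)⁻¹ * y) ?_ ?_ ?_ ?_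
    · intro y hy
      simp only [Finset.mem_filter, mem_sphere] at hy ⊢
      refine ⟨(hQ _ hy.2).1 ?_, hy.2⟩
      rw [mul_inv_cancel_left]; exact hy.1
    · intro y _ y' _ h
      exact mul_left_cancel h
    · intro z hz
      simp only [Finset.mem_filter, mem_sphere] at hz
      refine ⟨letter s * z, ?_, inv_mul_cancel_left _ _⟩
      simp only [Finset.mem_filter, mem_sphere, inv_mul_cancel_left]
      exact ⟨(hQ z hz.2).2 hz.1, hz.2⟩
    · intros; rfl
  congr 1
  · refine key P _ fun z hz => ?_
    simp only [hPdef] at hz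
    omega
  · refine key (fun z => ¬ P z) _ fun z hz => ?_
    have := norm_letter_mul s z
    simp only [hPdef] at hz
    omega

end Words

/-- A matrix system `(V_a, H_{ba})` over the symmetric set of letters `A = S × {±1}`. -/
structure MatrixSystem (S : Type v) where
  /-- the spaces `V_a` -/
  V : S × Bool → Type u
  [addCommGroup : ∀ a, AddCommGroup (V a)]
  [module : ∀ a, Module ℂ (V a)]
  [finiteDimensional : ∀ a, FiniteDimensional ℂ (V a)]
  /-- the linear maps `H_{ba} : V_a → V_b` -/
  H : ∀ b a, V a →ₗ[ℂ] V b
  H_eq_zero : ∀ b a, letter a * letter b = 1 → H b a = 0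

attribute [instance] MatrixSystem.addCommGroup MatrixSystem.module
  MatrixSystem.finiteDimensional

namespace MatrixSystem

variable {S : Type*} (M : MatrixSystem S)

/-- A tuple of subspaces `W_a ⊆ V_a` is an invariant subsystem if `H_{ba} W_a ⊆ W_b`. -/
def IsInvariant (W : ∀ a, Submodule ℂ (M.V a)) : Prop :=
  ∀ a b, ∀ v ∈ W a, M.H b a v ∈ W b

/-- A system is irreducible if it is nonzero and its only invariant subsystems are zero and
itself. -/
def IsIrreducible : Prop :=
  (∃ a, Nontrivial (M.V a)) ∧
    ∀ W : ∀ a, Submodule ℂ (M.V a), M.IsInvariant W → (∀ a, W a = ⊥) ∨ (∀ a, W a = ⊤)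

variable [DecidableEq S]

/-- `f` is multiplicative from radius `N` on. The disjoint union of the `V_a` is regarded as a
subset of their direct sum, so that `f x ∈ V_a` means that the other components of `f x`
vanish. -/
def IsMultFrom (N : ℕ) (f : FreeGroup S → ∀ a, M.V a) : Prop :=
  ∀ x : FreeGroup S, N ≤ x.norm → ∀ a, EndsWith x a →
    (∀ c, c ≠ a → f x c = 0) ∧
    ∀ b, (x * letter b).norm = x.norm + 1 → f (x * letter b) = Pi.single b (M.H b a (f x a))

variable {M}

theorem IsMultFrom.mono {N N' : ℕ} {f : FreeGroup S → ∀ a, M.V a} (h : M.IsMultFrom N f)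
    (hN : N ≤ N') : M.IsMultFrom N' f := fun x hx => h x (hN.trans hx)

theorem IsMultFrom.add {N : ℕ} {f g : FreeGroup S → ∀ a, M.V a} (hf : M.IsMultFrom N f)
    (hg : M.IsMultFrom N g) : M.IsMultFrom N (f + g) := by
  intro x hx a ha
  refine ⟨fun c hc => ?_, fun b hb => ?_⟩
  · simp [(hf x hx a ha).1 c hc, (hg x hx a ha).1 c hc]
  · simp [(hf x hx a ha).2 b hb, (hg x hx a ha).2 b hb, Pi.single_add]

theorem IsMultFrom.smul {N : ℕ} {f : FreeGroup S → ∀ a, M.V a} (r : ℂ)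
    (hf : M.IsMultFrom N f) : M.IsMultFrom N (r • f) := by
  intro x hx a ha
  refine ⟨fun c hc => ?_, fun b hb => ?_⟩
  · simp [(hf x hx a ha).1 c hc]
  · simp [(hf x hx a ha).2 b hb, Pi.single_smul]

variable (M)

/-- The space `H_0^∞` of multiplicative functions. -/
def MultFun : Submodule ℂ (FreeGroup S → ∀ a, M.V a) where
  carrier := {f | ∃ N, M.IsMultFrom N f}
  add_mem' := by
    rintro f g ⟨N, hf⟩ ⟨N', hg⟩
    exact ⟨max N N', (hf.mono (le_max_left _ _)).add (hg.mono (le_max_right _ _))⟩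
  zero_mem' := ⟨0, fun x _ a _ => by simp⟩
  smul_mem' := by
    rintro r f ⟨N, hf⟩
    exact ⟨N, hf.smul r⟩

variable {M} in
/-- The least `N` from which on the function is multiplicative. -/
noncomputable def radius (f : M.MultFun) : ℕ := sInf {N | M.IsMultFrom N f.1}

theorem isMultFrom_radius (f : M.MultFun) : M.IsMultFrom (radius f) f.1 :=
  Nat.sInf_mem (s := {N | M.IsMultFrom N f.1}) f.2

/-- The multiplicative functions which vanish at all but finitely many elements. -/
def Negligible : Submodule ℂ M.MultFun where
  carrier := {f | {x | f.1 x ≠ 0}.Finite}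
  add_mem' := by
    intro f g hf hg
    refine (hf.union hg).subset fun x hx => ?_
    by_contra h
    simp only [Set.mem_union, Set.mem_ofPred_eq, not_or, not_not] at h
    exact hx (show f.1 x + g.1 x = 0 by rw [h.1, h.2, add_zero])
  zero_mem' := by simp
  smul_mem' := by
    intro r f hf
    refine Set.Finite.subset hf fun x hx h => hx (by simp [h])

/-- The action `(π(x) f)(y) = f(x⁻¹ y)` on all functions. -/
def translate (x : FreeGroup S) :
    (FreeGroup S → ∀ a, M.V a) →ₗ[ℂ] (FreeGroup S → ∀ a, M.V a) where
  toFun f := fun y => f (x⁻¹ * y)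
  map_add' _ _ := rfl
  map_smul' _ _ := rfl

theorem letter_inv {S : Type*} (a : S × Bool) : (letter a)⁻¹ = letter (a.1, !a.2) := rfl

variable {M} in
theorem IsMultFrom.translate_letter {N : ℕ} {f : FreeGroup S → ∀ a, M.V a}
    (hf : M.IsMultFrom N f) (s : S × Bool) :
    M.IsMultFrom (N + 2) (M.translate (letter s) f) := by
  intro x hx a ha
  have h2 : 2 ≤ x.norm := by omega
  have h1 : N ≤ ((letter s)⁻¹ * x).norm := by
    have := norm_letter_mul (s.1, !s.2) x
    rw [letter_inv]
    omega
  have h := hf _ h1 a (by rw [letter_inv]; exact (endsWith_letter_mul h2).2 ha)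
  refine ⟨h.1, fun b hb => ?_⟩
  have := h.2 b (by rw [letter_inv]; exact (norm_letter_mul_mul_letter_iff h2).2 hb)
  simpa [translate, mul_assoc] using this

theorem translate_mem (x : FreeGroup S) :
    ∀ f ∈ M.MultFun, M.translate x f ∈ M.MultFun := by
  induction x using letter_induction with
  | h1 => intro f hf; simpa [translate] using hf
  | hl s => rintro f ⟨N, hf⟩; exact ⟨N + 2, hf.translate_letter s⟩
  | hm x y hx hy =>
    intro f hf
    have := hx _ (hy f hf)
    simpa [translate, mul_assoc] using this

/-- The action of the free group on `H_0^∞`. -/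
def translateMult (x : FreeGroup S) : M.MultFun →ₗ[ℂ] M.MultFun :=
  (M.translate x).restrict (M.translate_mem x)

@[simp] theorem translateMult_apply (x y : FreeGroup S) (f : M.MultFun) :
    (M.translateMult x f).1 y = f.1 (x⁻¹ * y) := rfl

theorem translateMult_negligible (x : FreeGroup S) :
    M.Negligible ≤ M.Negligible.comap (M.translateMult x) := by
  intro f hf
  refine (Set.Finite.image (fun y => x * y) hf).subset fun y hy => ⟨x⁻¹ * y, hy, ?_⟩
  simp

end MatrixSystem

/-- A matrix system with inner products `(V_a, H_{ba}, B_a)`: the forms are positive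
semi-definite and satisfy the compatibility condition. -/
structure InnerSystem (S : Type v) [Fintype S] extends MatrixSystem.{u, v} S where
  /-- the sesquilinear forms `B_a`, conjugate-linear in the first variable -/
  B : ∀ a, V a →ₗ⋆[ℂ] V a →ₗ[ℂ] ℂ
  B_symm : ∀ a v w, conj (B a v w) = B a w v
  B_nonneg : ∀ a v, 0 ≤ (B a v v).re
  B_compat : ∀ a v, B a v v = ∑ b, B b (H b a v) (H b a v)

namespace InnerSystem

variable {S : Type*} [Fintype S] (σ : InnerSystem S)

/-- All the forms `B_a` are strictly positive definite. -/
def IsPosDef : Prop :=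
  ∀ a v, v ≠ 0 → 0 < (σ.B a v v).re

theorem B_compat_polar (a : S × Bool) (v w : σ.V a) :
    ∑ b, σ.B b (σ.H b a v) (σ.H b a w) = σ.B a v w := by
  have h1 := σ.B_compat a (v + w)
  have h2 := σ.B_compat a (v + Complex.I • w)
  have hv := σ.B_compat a v
  have hw := σ.B_compat a w
  simp only [map_add, map_smul, LinearMap.add_apply, LinearMap.map_smulₛₗ, LinearMap.smul_apply,
    Finset.sum_add_distrib, smul_eq_mul, Complex.conj_I,
    ← Finset.mul_sum] at h1 h2
  rw [← hv, ← hw] at h1 h2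
  linear_combination (1 / 2) * (-h1 + Complex.I * h2) +
    (1 / 2) * (σ.B a w v - σ.B a v w + ∑ b, σ.B b (σ.H b a v) (σ.H b a w) -
      ∑ b, σ.B b (σ.H b a w) (σ.H b a v)) * Complex.I_sq

variable [DecidableEq S]

/-- The sum `∑_{|x| = n} ∑_{|xa| = |x| + 1} B_a(f(xa), g(xa))`. -/
noncomputable def level (n : ℕ) (f g : σ.MultFun) : ℂ :=
  ∑ x ∈ sphere S n, ∑ a with (x * letter a).norm = x.norm + 1,
    σ.B a (f.1 (x * letter a) a) (g.1 (x * letter a) a)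

/-- The inner product of two multiplicative functions: the sum `level N`, where `N` is large
enough for both functions to be multiplicative from `N` on. -/
noncomputable def pairing (f g : σ.MultFun) : ℂ :=
  σ.level (max (MatrixSystem.radius f) (MatrixSystem.radius g)) f g

/-- The summand `B_a(f(y), g(y))` at an element `y` which ends with `a`. -/
noncomputable def weight (f g : σ.MultFun) (y : FreeGroup S) : ℂ :=
  (y.toWord.getLast?).elim 0 fun a => σ.B a (f.1 y a) (g.1 y a)

theorem weight_eq (f g : σ.MultFun) {y : FreeGroup S} {a : S × Bool} (h : EndsWith y a) :
    σ.weight f g y = σ.B a (f.1 y a) (g.1 y a) := by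
  rw [EndsWith] at h
  simp [weight, h]

theorem level_eq_sum (n : ℕ) (f g : σ.MultFun) :
    σ.level n f g = ∑ y ∈ sphere S (n + 1), σ.weight f g y := by
  have := sum_sphere_succ (σ.weight f g) n (fun _ => True)
  simp only [and_true, Finset.filter_true] at this
  rw [← this, level]
  refine Finset.sum_congr rfl fun x _ => Finset.sum_congr rfl fun a ha => ?_
  simp only [Finset.mem_filter, Finset.mem_univ, true_and] at ha
  rw [weight_eq σ f g (endsWith_mul_letter ha)]

theorem weight_sum {N : ℕ} {f g : σ.MultFun} (hf : σ.IsMultFrom N f.1)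
    (hg : σ.IsMultFrom N g.1) (y : FreeGroup S) (hy : N ≤ y.norm) (hy0 : y.norm ≠ 0) :
    ∑ b with (y * letter b).norm = y.norm + 1, σ.weight f g (y * letter b) =
      σ.weight f g y := by
  obtain ⟨a, ha⟩ := exists_endsWith hy0
  rw [weight_eq σ f g ha, ← σ.B_compat_polar, Finset.sum_filter]
  refine Finset.sum_congr rfl fun b _ => ?_
  split_ifs with hb
  · rw [weight_eq σ f g (endsWith_mul_letter hb), (hf y hy a ha).2 b hb, (hg y hy a ha).2 b hb]
    simp
  · rw [norm_mul_letter_iff ha, not_not] at hb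
    simp [σ.H_eq_zero b a hb]

theorem level_succ {N : ℕ} {f g : σ.MultFun} (hf : σ.IsMultFrom N f.1)
    (hg : σ.IsMultFrom N g.1) {n : ℕ} (hn : N ≤ n) :
    σ.level (n + 1) f g = σ.level n f g := by
  rw [σ.level_eq_sum n, level]
  refine Finset.sum_congr rfl fun y hy => ?_
  rw [mem_sphere] at hy
  rw [← weight_sum σ hf hg y (by omega) (by omega)]
  refine Finset.sum_congr rfl fun b hb => ?_
  simp only [Finset.mem_filter, Finset.mem_univ, true_and] at hb
  rw [weight_eq σ f g (endsWith_mul_letter hb)]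

/-- The inner product does not depend on the choice of the (large) radius. -/
theorem pairing_eq {n : ℕ} {f g : σ.MultFun} (hf : σ.IsMultFrom n f.1)
    (hg : σ.IsMultFrom n g.1) : σ.pairing f g = σ.level n f g := by
  have hmf := Nat.sInf_le (s := {N | σ.IsMultFrom N f.1}) hf
  have hmg := Nat.sInf_le (s := {N | σ.IsMultFrom N g.1}) hg
  have hle : max (MatrixSystem.radius f) (MatrixSystem.radius g) ≤ n := max_le hmf hmg
  rw [pairing]
  clear hf hg hmf hmg
  induction n, hle using Nat.le_induction with
  | base => rfl
  | succ k hk ih =>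
  rw [ih]
  refine Eq.symm ?_
  exact σ.level_succ ((σ.isMultFrom_radius f).mono (le_max_left _ _))
    ((σ.isMultFrom_radius g).mono (le_max_right _ _)) hk

theorem exists_isMultFrom (f g : σ.MultFun) :
    ∃ N, σ.IsMultFrom N f.1 ∧ σ.IsMultFrom N g.1 :=
  ⟨_, (σ.isMultFrom_radius f).mono (le_max_left _ _),
    (σ.isMultFrom_radius g).mono (le_max_right _ _)⟩

theorem pairing_symm (f g : σ.MultFun) : conj (σ.pairing g f) = σ.pairing f g := by
  obtain ⟨N, hf, hg⟩ := σ.exists_isMultFrom f g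
  rw [σ.pairing_eq hf hg, σ.pairing_eq hg hf, level, level]
  simp [map_sum, σ.B_symm]

theorem pairing_nonneg (f : σ.MultFun) : 0 ≤ (σ.pairing f f).re := by
  obtain ⟨N, hf, -⟩ := σ.exists_isMultFrom f f
  rw [σ.pairing_eq hf hf, level]
  simp only [Complex.re_sum]
  exact Finset.sum_nonneg fun x _ => Finset.sum_nonneg fun a _ => σ.B_nonneg _ _

theorem pairing_add (f f' g : σ.MultFun) :
    σ.pairing (f + f') g = σ.pairing f g + σ.pairing f' g := by
  obtain ⟨N, hf, hg⟩ := σ.exists_isMultFrom f g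
  obtain ⟨N', hf', -⟩ := σ.exists_isMultFrom f' g
  have hf := hf.mono (le_max_left N N')
  have hg := hg.mono (le_max_left N N')
  have hf' := hf'.mono (le_max_right N N')
  rw [σ.pairing_eq hf hg, σ.pairing_eq hf' hg, σ.pairing_eq (hf.add hf') hg]
  simp [level, Finset.sum_add_distrib]

theorem pairing_smul (r : ℂ) (f g : σ.MultFun) :
    σ.pairing (r • f) g = conj r * σ.pairing f g := by
  obtain ⟨N, hf, hg⟩ := σ.exists_isMultFrom f g
  rw [σ.pairing_eq hf hg, σ.pairing_eq (hf.smul r) hg]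
  simp [level, Finset.mul_sum]

theorem pairing_congr_left {f f' : σ.MultFun} (h : f - f' ∈ σ.Negligible) (g : σ.MultFun) :
    σ.pairing f g = σ.pairing f' g := by
  obtain ⟨N, hf, hg⟩ := σ.exists_isMultFrom f g
  obtain ⟨N', hf', -⟩ := σ.exists_isMultFrom f' g
  obtain ⟨K, hK⟩ := (h.image FreeGroup.norm).bddAbove
  set L := max (max N N') K
  have hN : N ≤ L := (le_max_left _ _).trans (le_max_left _ _)
  have hN' : N' ≤ L := (le_max_right _ _).trans (le_max_left _ _)
  rw [σ.pairing_eq (hf.mono hN) (hg.mono hN), σ.pairing_eq (hf'.mono hN') (hg.mono hN),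
    level, level]
  refine Finset.sum_congr rfl fun x hx => Finset.sum_congr rfl fun a ha => ?_
  rw [mem_sphere] at hx
  simp only [Finset.mem_filter, Finset.mem_univ, true_and] at ha
  have : f.1 (x * letter a) = f'.1 (x * letter a) := by
    by_contra hne
    have := hK (Set.mem_image_of_mem FreeGroup.norm
      (show x * letter a ∈ {x | (f - f').1 x ≠ 0} by
        simpa [sub_eq_zero] using hne))
    have := le_max_right (max N N') K
    omega
  rw [this]

theorem pairing_congr {f f' g g' : σ.MultFun} (h : f - f' ∈ σ.Negligible)
    (h' : g - g' ∈ σ.Negligible) : σ.pairing f g = σ.pairing f' g' := by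
  rw [σ.pairing_congr_left h, ← σ.pairing_symm, σ.pairing_congr_left h', σ.pairing_symm]

theorem pairing_translate (x : FreeGroup S) : ∀ f g : σ.MultFun,
    σ.pairing (σ.translateMult x f) (σ.translateMult x g) = σ.pairing f g := by
  induction x using letter_induction with
  | h1 =>
    intro f g
    have : ∀ f : σ.MultFun, σ.translateMult 1 f = f := fun f => by
      ext y : 2
      simp
    rw [this, this]
  | hm x y hx hy =>
    intro f g
    have : ∀ f : σ.MultFun,
        σ.translateMult (x * y) f = σ.translateMult x (σ.translateMult y f) := fun f => by
      ext z : 2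
      simp [mul_assoc]
    rw [this, this, hx, hy]
  | hl s =>
    intro f g
    obtain ⟨N, hf, hg⟩ := σ.exists_isMultFrom f g
    rw [σ.pairing_eq (hf.mono (Nat.le_add_right N 2)) (hg.mono (Nat.le_add_right N 2)),
      σ.pairing_eq (n := N + 2) (hf.translate_letter s) (hg.translate_letter s), level_eq_sum,
      level_eq_sum,
      ← sum_sphere_translate (σ.weight f g) N (σ.weight_sum hf hg) s (N + 2 + 1) (by omega)]
    refine Finset.sum_congr rfl fun y hy => ?_
    rw [mem_sphere] at hy
    obtain ⟨a, ha⟩ := exists_endsWith (x := y) (by omega)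
    rw [weight_eq σ _ _ ha, weight_eq σ f g (a := a)]
    · rfl
    · rw [MatrixSystem.letter_inv]
      exact (endsWith_letter_mul (by omega)).2 ha

/-- The space `H^∞` of classes of multiplicative functions modulo equality at all but finitely
many elements, with the (semi-definite) inner product given by the forms `B_a`. -/
def PreHilbert : Type _ := σ.MultFun ⧸ σ.Negligible

noncomputable instance : AddCommGroup σ.PreHilbert :=
  inferInstanceAs (AddCommGroup (σ.MultFun ⧸ σ.Negligible))

noncomputable instance : Module ℂ σ.PreHilbert :=
  inferInstanceAs (Module ℂ (σ.MultFun ⧸ σ.Negligible))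

/-- The class in `H^∞` of a multiplicative function. -/
def toPreHilbert : σ.MultFun →ₗ[ℂ] σ.PreHilbert := σ.Negligible.mkQ

theorem toPreHilbert_surjective : Function.Surjective σ.toPreHilbert :=
  σ.Negligible.mkQ_surjective

/-- The inner product induced by `pairing` on `H^∞`. -/
@[reducible] noncomputable def core : PreInnerProductSpace.Core ℂ σ.PreHilbert where
  inner p q := Quotient.liftOn₂' p q σ.pairing fun _ _ _ _ h h' =>
    σ.pairing_congr ((Submodule.quotientRel_def _).1 h) ((Submodule.quotientRel_def _).1 h')
  conj_inner_symm p q := by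
    obtain ⟨f, rfl⟩ := σ.toPreHilbert_surjective p
    obtain ⟨g, rfl⟩ := σ.toPreHilbert_surjective q
    exact σ.pairing_symm f g
  re_inner_nonneg p := by
    obtain ⟨f, rfl⟩ := σ.toPreHilbert_surjective p
    exact σ.pairing_nonneg f
  add_left p p' q := by
    obtain ⟨f, rfl⟩ := σ.toPreHilbert_surjective p
    obtain ⟨f', rfl⟩ := σ.toPreHilbert_surjective p'
    obtain ⟨g, rfl⟩ := σ.toPreHilbert_surjective q
    exact σ.pairing_add f f' g
  smul_left p q r := by
    obtain ⟨f, rfl⟩ := σ.toPreHilbert_surjective p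
    obtain ⟨g, rfl⟩ := σ.toPreHilbert_surjective q
    exact σ.pairing_smul r f g

noncomputable instance : SeminormedAddCommGroup σ.PreHilbert :=
  @InnerProductSpace.Core.toSeminormedAddCommGroup ℂ σ.PreHilbert _ _ _ σ.core

noncomputable instance : InnerProductSpace ℂ σ.PreHilbert := InnerProductSpace.ofCore σ.core

theorem inner_toPreHilbert (f g : σ.MultFun) :
    inner ℂ (σ.toPreHilbert f) (σ.toPreHilbert g) = σ.pairing f g := rfl

/-- The action of the free group on `H^∞`. -/
noncomputable def preRep (x : FreeGroup S) : σ.PreHilbert →ₗᵢ[ℂ] σ.PreHilbert :=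
  LinearMap.isometryOfInner
    (σ.Negligible.mapQ σ.Negligible (σ.translateMult x) (σ.translateMult_negligible x)) (by
      intro p q
      obtain ⟨f, rfl⟩ := σ.toPreHilbert_surjective p
      obtain ⟨g, rfl⟩ := σ.toPreHilbert_surjective q
      exact σ.pairing_translate x f g)

theorem preRep_toPreHilbert (x : FreeGroup S) (f : σ.MultFun) :
    σ.preRep x (σ.toPreHilbert f) = σ.toPreHilbert (σ.translateMult x f) := rfl

theorem preRep_one (p : σ.PreHilbert) : σ.preRep 1 p = p := by
  obtain ⟨f, rfl⟩ := σ.toPreHilbert_surjective p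
  rw [preRep_toPreHilbert]
  congr 1
  ext y : 2
  simp

theorem preRep_mul (x y : FreeGroup S) (p : σ.PreHilbert) :
    σ.preRep (x * y) p = σ.preRep x (σ.preRep y p) := by
  obtain ⟨f, rfl⟩ := σ.toPreHilbert_surjective p
  simp only [preRep_toPreHilbert]
  congr 1
  ext z : 2
  simp [mul_assoc]

/-- The Hilbert space `H(V_a, H_{ba}, B_a)`, the (separated) completion of `H^∞`. -/
abbrev Hilbert : Type _ := UniformSpace.Completion σ.PreHilbert

/-- The continuous extension of the action to the completion. -/
noncomputable def repCLM (x : FreeGroup S) : σ.Hilbert →L[ℂ] σ.Hilbert :=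
  (σ.preRep x).toContinuousLinearMap.completion

theorem repCLM_coe (x : FreeGroup S) (p : σ.PreHilbert) :
    σ.repCLM x (p : σ.Hilbert) = (σ.preRep x p : σ.Hilbert) :=
  ContinuousLinearMap.completion_apply_coe _ _

theorem repCLM_norm (x : FreeGroup S) (ξ : σ.Hilbert) : ‖σ.repCLM x ξ‖ = ‖ξ‖ := by
  induction ξ using UniformSpace.Completion.induction_on with
  | hp => exact isClosed_eq (by fun_prop) (by fun_prop)
  | ih p => rw [repCLM_coe]; simp

theorem repCLM_one (ξ : σ.Hilbert) : σ.repCLM 1 ξ = ξ := by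
  induction ξ using UniformSpace.Completion.induction_on with
  | hp => exact isClosed_eq (by fun_prop) (by fun_prop)
  | ih p => rw [repCLM_coe, preRep_one]

theorem repCLM_mul (x y : FreeGroup S) (ξ : σ.Hilbert) :
    σ.repCLM (x * y) ξ = σ.repCLM x (σ.repCLM y ξ) := by
  induction ξ using UniformSpace.Completion.induction_on with
  | hp => exact isClosed_eq (by fun_prop) (by fun_prop)
  | ih p => rw [repCLM_coe, repCLM_coe, repCLM_coe, preRep_mul]

/-- The unitary representation of the free group on `H(V_a, H_{ba}, B_a)` which extends
`(π(x) f)(y) = f(x⁻¹ y)`. -/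
noncomputable def rep : FreeGroup S →* (σ.Hilbert ≃ₗᵢ[ℂ] σ.Hilbert) where
  toFun x :=
    { toFun := σ.repCLM x
      map_add' := map_add _
      map_smul' := map_smul _
      invFun := σ.repCLM x⁻¹
      left_inv := fun ξ => by rw [← repCLM_mul, inv_mul_cancel, repCLM_one]
      right_inv := fun ξ => by rw [← repCLM_mul, mul_inv_cancel, repCLM_one]
      norm_map' := σ.repCLM_norm x }
  map_one' := LinearIsometryEquiv.ext σ.repCLM_one
  map_mul' x y := LinearIsometryEquiv.ext (σ.repCLM_mul x y)

theorem rep_coe (x : FreeGroup S) (f : σ.MultFun) :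
    σ.rep x (σ.toPreHilbert f : σ.Hilbert) =
      (σ.toPreHilbert (σ.translateMult x f) : σ.Hilbert) :=
  σ.repCLM_coe x _

end InnerSystem

end MultRep

/-! The proof is by strong induction on the total dimension `∑ a, finrank (V a)`. Two cases stop the
induction. If every form vanishes, the Hilbert space is zero and the empty sum works. If the system
is irreducible and some form is nonzero, the radicals of the forms make up an invariant subsystem,
which must then be zero, so the forms are positive definite.

Otherwise there is a proper nonzero invariant subsystem `W`. Its Hilbert space embeds isometrically
and equivariantly in that of `V`. The crux is that the orthogonal complement is again constructed
from a matrix system, namely the quotient `V / W`, with new forms. Let `P` be the projection onto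
the complement. For `v` in `V a`, let `B'_a(v, v)` be the squared norm of `P` applied to the
multiplicative function supported on the cone of words beginning with `a`, with value `v` at `a`.

These forms work because `P` commutes with the representation and with restriction to cones: both
families of operators preserve the range of `W` and are closed under adjoints (`complProj_comm`).
Hence `P f` splits orthogonally along the cones based on a large sphere, and each piece is a
translate of one of the vectors defining `B'`. So `‖P f‖²` is the sum that defines the inner product
for the quotient system (`inner_complProj_self`). This formula gives both the compatibility
condition for `B'` (`inner_coneCompl_self`) and the isometry of the complement with the Hilbert
space of the quotient (`pairing_proj`, `complToQuot_surjective`). Subsystem and quotient both have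
smaller dimension, and `IsDecomposable.of_sub_of_quot` combines their decompositions. -/

namespace MultRep

/-! ### Reduced words beginning with a given word. -/

section Prefixes

variable {S : Type*} [DecidableEq S]

theorem toWord_mk_of_toWord_eq_append {x : FreeGroup S} {l t : List (S × Bool)}
    (h : x.toWord = l ++ t) : (FreeGroup.mk l).toWord = l ∧ (FreeGroup.mk t).toWord = t := by
  have hr : FreeGroup.IsReduced (l ++ t) := h ▸ FreeGroup.isReduced_toWord
  have h1 : FreeGroup.IsReduced l := (List.isChain_append.1 hr).1
  have h2 : FreeGroup.IsReduced t := (List.isChain_append.1 hr).2.1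
  exact ⟨by rw [FreeGroup.toWord_mk, h1.reduce_eq], by rw [FreeGroup.toWord_mk, h2.reduce_eq]⟩

theorem prefix_mul_letter_iff {x y : FreeGroup S} {b : S × Bool}
    (hb : (x * letter b).norm = x.norm + 1) (hy : y.norm ≤ x.norm) :
    y.toWord <+: (x * letter b).toWord ↔ y.toWord <+: x.toWord := by
  rw [toWord_mul_letter_of_norm hb, List.prefix_concat_iff, or_iff_right]
  intro h
  have := congrArg List.length h
  simp only [FreeGroup.norm] at hy
  simp at this
  omega

theorem prefix_iff_eq_of_norm_eq {x y : FreeGroup S} (h : y.norm = x.norm) :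
    y.toWord <+: x.toWord ↔ y = x :=
  ⟨fun hp => FreeGroup.toWord_injective (hp.eq_of_length h), fun h => h ▸ List.prefix_rfl⟩

/-- Reducedness is a condition on neighbouring letters, so the reduced words `x a` and `a t`, which
share the letter `a`, glue to a reduced word. This identifies the cone at `x a` with the translate
by `x` of the cone at `a`. -/
theorem toWord_eq_append_iff {x z : FreeGroup S} {a : S × Bool} {t : List (S × Bool)}
    (ha : (x * letter a).norm = x.norm + 1) :
    z.toWord = (x * letter a).toWord ++ t ↔ (x⁻¹ * z).toWord = a :: t := by
  have hw := toWord_mul_letter_of_norm ha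
  rw [hw, List.append_assoc, List.singleton_append]
  constructor
  · intro h
    have h1 : x⁻¹ * z = FreeGroup.mk (a :: t) := by
      rw [inv_mul_eq_iff_eq_mul, ← FreeGroup.mk_toWord (x := z), h, ← FreeGroup.mul_mk,
        FreeGroup.mk_toWord]
    rw [h1]
    exact (toWord_mk_of_toWord_eq_append h).2
  · intro h
    have h1 : z = FreeGroup.mk (x.toWord ++ a :: t) := by
      rw [← FreeGroup.mul_mk, FreeGroup.mk_toWord, ← inv_mul_eq_iff_eq_mul, ← h,
        FreeGroup.mk_toWord]
    rw [h1, FreeGroup.toWord_mk]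
    apply FreeGroup.IsReduced.reduce_eq
    have r1 : FreeGroup.IsReduced (x.toWord ++ [a]) := hw ▸ FreeGroup.isReduced_toWord
    have r2 : FreeGroup.IsReduced (a :: t) := h ▸ FreeGroup.isReduced_toWord
    rw [FreeGroup.IsReduced] at r1 r2 ⊢
    rw [List.isChain_append] at r1 ⊢
    exact ⟨r1.1, r2, by simpa using r1.2.2⟩

end Prefixes

namespace MatrixSystem

/-! ### Morphisms of matrix systems and their action on multiplicative functions. -/

section Hom

variable {S : Type*}

/-- A morphism of matrix systems. -/
structure Hom (M M' : MatrixSystem S) where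
  /-- the components of the morphism -/
  app : ∀ a, M.V a →ₗ[ℂ] M'.V a
  comm : ∀ b a v, app b (M.H b a v) = M'.H b a (app a v)

variable {M M' : MatrixSystem S} [DecidableEq S]

theorem Hom.isMultFrom (φ : M.Hom M') {N : ℕ} {f : FreeGroup S → ∀ a, M.V a}
    (hf : M.IsMultFrom N f) : M'.IsMultFrom N (fun x a => φ.app a (f x a)) := by
  intro x hx a ha
  refine ⟨fun c hc => by simp only [(hf x hx a ha).1 c hc, map_zero], fun b hb => ?_⟩
  dsimp only
  rw [(hf x hx a ha).2 b hb, ← φ.comm]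
  ext c
  exact Pi.apply_single (fun c => φ.app c) (fun c => map_zero _) b _ c

/-- The map of multiplicative functions induced by a morphism. -/
def Hom.mapMult (φ : M.Hom M') : M.MultFun →ₗ[ℂ] M'.MultFun where
  toFun f := ⟨fun x a => φ.app a (f.1 x a), f.2.imp fun _ h => φ.isMultFrom h⟩
  map_add' f g := by ext x a; simp
  map_smul' r f := by ext x a; simp

@[simp] theorem Hom.mapMult_apply (φ : M.Hom M') (f : M.MultFun) (x : FreeGroup S)
    (a : S × Bool) : (φ.mapMult f).1 x a = φ.app a (f.1 x a) := rfl

theorem Hom.mapMult_negligible (φ : M.Hom M') :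
    M.Negligible ≤ M'.Negligible.comap φ.mapMult := by
  intro f hf
  refine Set.Finite.subset hf fun x hx h => hx ?_
  ext a
  simp [h]

theorem Hom.mapMult_translateMult (φ : M.Hom M') (x : FreeGroup S) (f : M.MultFun) :
    φ.mapMult (M.translateMult x f) = M'.translateMult x (φ.mapMult f) := rfl

end Hom

/-! ### Restriction of multiplicative functions to cones. -/

section Cut

variable {S : Type*} {M : MatrixSystem S} [DecidableEq S]

/-- Beyond radius `|y|`, appending a letter does not change whether a word begins with `y`, so the
indicator function of the cone is constant along the multiplicativity relation. -/
theorem IsMultFrom.cut {N : ℕ} {f : FreeGroup S → ∀ a, M.V a} (hf : M.IsMultFrom N f)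
    (y : FreeGroup S) :
    M.IsMultFrom (max N y.norm) fun x => if y.toWord <+: x.toWord then f x else 0 := by
  intro x hx a ha
  have h := hf x ((le_max_left _ _).trans hx) a ha
  refine ⟨fun c hc => ?_, fun b hb => ?_⟩
  · dsimp only
    split_ifs
    · exact h.1 c hc
    · rfl
  · simp only [prefix_mul_letter_iff hb ((le_max_right _ _).trans hx)]
    split_ifs
    · exact h.2 b hb
    · simp

variable (M) in
/-- The restriction of multiplicative functions to the cone of words which begin with `y`. -/
def cut (y : FreeGroup S) : M.MultFun →ₗ[ℂ] M.MultFun where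
  toFun f := ⟨fun x => if y.toWord <+: x.toWord then f.1 x else 0, by
    obtain ⟨N, h⟩ := f.2
    exact ⟨_, h.cut y⟩⟩
  map_add' f g := by
    ext x : 2
    simp only [Submodule.coe_add, Pi.add_apply]
    split_ifs <;> simp
  map_smul' r f := by
    ext x : 2
    simp only [Submodule.coe_smul, Pi.smul_apply, RingHom.id_apply]
    split_ifs <;> simp

theorem cut_apply (y x : FreeGroup S) (f : M.MultFun) :
    (M.cut y f).1 x = if y.toWord <+: x.toWord then f.1 x else 0 := rfl

theorem cut_negligible (y : FreeGroup S) : M.Negligible ≤ M.Negligible.comap (M.cut y) := by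
  intro f hf
  refine Set.Finite.subset hf fun x hx h => hx ?_
  rw [cut_apply, h, ite_self]

theorem Hom.mapMult_cut {M' : MatrixSystem S} (φ : M.Hom M') (y : FreeGroup S)
    (f : M.MultFun) : φ.mapMult (M.cut y f) = M'.cut y (φ.mapMult f) := by
  ext x a
  simp only [mapMult_apply, cut_apply]
  split_ifs <;> simp

theorem cut_cut_of_ne {y z : FreeGroup S} (h : y.norm = z.norm) (hne : y ≠ z)
    (f : M.MultFun) : M.cut y (M.cut z f) = 0 := by
  ext x : 2
  simp only [cut_apply]
  split_ifs with h1 h2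
  · refine absurd (FreeGroup.toWord_injective ?_) hne
    exact (List.prefix_of_prefix_length_le h1 h2 h.le).eq_of_length h
  · rfl
  · rfl

theorem cut_cut_self (y : FreeGroup S) (f : M.MultFun) : M.cut y (M.cut y f) = M.cut y f := by
  ext x : 2
  simp only [cut_apply]
  split_ifs <;> rfl

theorem mem_negligible_of_norm [Fintype S] {f : M.MultFun} (n : ℕ)
    (h : ∀ x : FreeGroup S, n ≤ x.norm → f.1 x = 0) : f ∈ M.Negligible := by
  have hfin : (⋃ k ∈ Finset.range n, {x : FreeGroup S | x.norm = k}).Finite :=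
    Set.Finite.biUnion (Finset.finite_toSet _) fun k _ => finite_norm_eq k
  refine hfin.subset fun x hx => ?_
  simp only [Finset.mem_range, Set.mem_iUnion, Set.mem_ofPred_eq, exists_prop,
    exists_eq_right']
  by_contra hn
  exact hx (h x (not_lt.1 hn))

/-- A word of length at least `n` lies in exactly one cone based on the sphere of radius `n`, the
one at its prefix of length `n`. Only the finitely many shorter words are lost. -/
theorem sub_sum_cut_mem_negligible [Fintype S] (f : M.MultFun) (n : ℕ) :
    f - ∑ y ∈ sphere S n, M.cut y f ∈ M.Negligible := by
  refine mem_negligible_of_norm n fun x hx => ?_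
  have h1 : (FreeGroup.mk (x.toWord.take n)).toWord = x.toWord.take n :=
    (toWord_mk_of_toWord_eq_append (List.take_append_drop n x.toWord).symm).1
  have hn : (FreeGroup.mk (x.toWord.take n)).norm = n := by
    rw [FreeGroup.norm, h1]
    simpa [FreeGroup.norm] using hx
  have : (∑ y ∈ sphere S n, M.cut y f).1 x = f.1 x := by
    rw [AddSubmonoidClass.coe_finsetSum, Finset.sum_apply,
      Finset.sum_eq_single (FreeGroup.mk (x.toWord.take n))]
    · rw [cut_apply, if_pos]
      rw [h1]
      exact List.take_prefix _ _
    · intro y hy hne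
      rw [mem_sphere] at hy
      rw [cut_apply, if_neg]
      intro hp
      refine hne (FreeGroup.toWord_injective ?_)
      rw [h1, List.prefix_iff_eq_take.1 hp]
      congr 1
    · intro h
      exact absurd (mem_sphere.2 hn) h
  rw [Submodule.coe_sub, Pi.sub_apply, this, sub_self]

end Cut

/-! ### Multiplicative functions supported on a single cone. -/

section Cone

variable {S : Type*} [Fintype S] (M : MatrixSystem S) [DecidableEq S]

/-- The transition `⨁ V_a → V_b` given by the maps `H_{ba}`. -/
def step (b : S × Bool) : (∀ a, M.V a) →ₗ[ℂ] (∀ a, M.V a) :=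
  LinearMap.single ℂ M.V b ∘ₗ ∑ a, M.H b a ∘ₗ LinearMap.proj a

/-- The composition of the transitions along a word. -/
def run : List (S × Bool) → (∀ a, M.V a) →ₗ[ℂ] (∀ a, M.V a)
  | [] => LinearMap.id
  | b :: t => run t ∘ₗ M.step b

variable {M}

theorem step_apply (b : S × Bool) (w : ∀ a, M.V a) :
    M.step b w = Pi.single b (∑ a, M.H b a (w a)) := by
  simp [step]

theorem step_of_eq_zero {a b : S × Bool} {w : ∀ a, M.V a} (h : ∀ c, c ≠ a → w c = 0) :
    M.step b w = Pi.single b (M.H b a (w a)) := by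
  rw [step_apply, Finset.sum_eq_single a]
  · intro c _ hc
    rw [h c hc, map_zero]
  · simp

theorem run_concat (t : List (S × Bool)) (b : S × Bool) (w : ∀ a, M.V a) :
    M.run (t ++ [b]) w = M.step b (M.run t w) := by
  induction t generalizing w with
  | nil => rfl
  | cons c t ih => exact ih _

/-- The radius is `|y| + 1` and not `|y|` because the value `w` at `y` itself may have several
nonzero components; a single transition already lands in one component. -/
theorem isMultFrom_cone (y : FreeGroup S) (w : ∀ a, M.V a) :
    M.IsMultFrom (y.norm + 1) fun x =>
      if y.toWord <+: x.toWord then M.run (x.toWord.drop y.norm) w else 0 := by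
  intro x hx a ha
  dsimp only
  have key : ∀ c, c ≠ a → (if y.toWord <+: x.toWord then
      M.run (x.toWord.drop y.norm) w else 0) c = 0 := by
    intro c hc
    split_ifs with h
    · obtain ⟨l, hl⟩ := List.getLast?_eq_some_iff.1 ha
      have : y.norm ≤ l.length := by
        have := congrArg List.length hl
        rw [← FreeGroup.norm, List.length_append, List.length_singleton] at this
        omega
      rw [hl, List.drop_append_of_le_length this, run_concat, step_apply,
        Pi.single_eq_of_ne hc]
    · rfl
  refine ⟨key, fun b hb => ?_⟩
  rw [← step_of_eq_zero key]
  simp only [prefix_mul_letter_iff hb (show y.norm ≤ x.norm by omega)]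
  split_ifs with h
  · rw [toWord_mul_letter_of_norm hb, List.drop_append_of_le_length, run_concat]
    change y.norm ≤ x.norm
    omega
  · simp

variable (M) in
/-- The multiplicative function supported on the cone of words which begin with `y`, with
value `w` at `y`. -/
def cone (y : FreeGroup S) : (∀ a, M.V a) →ₗ[ℂ] M.MultFun where
  toFun w := ⟨_, _, isMultFrom_cone y w⟩
  map_add' w w' := by
    ext x : 2
    simp only [Submodule.coe_add, Pi.add_apply, map_add]
    split_ifs <;> simp
  map_smul' r w := by
    ext x : 2
    simp only [Submodule.coe_smul, Pi.smul_apply, RingHom.id_apply, map_smul]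
    split_ifs <;> simp

theorem cone_apply (y x : FreeGroup S) (w : ∀ a, M.V a) :
    (M.cone y w).1 x = if y.toWord <+: x.toWord then M.run (x.toWord.drop y.norm) w else 0 :=
  rfl

theorem run_comm {M' : MatrixSystem S} (φ : M.Hom M') (t : List (S × Bool))
    (w : ∀ a, M.V a) (a : S × Bool) :
    φ.app a (M.run t w a) = M'.run t (fun c => φ.app c (w c)) a := by
  induction t generalizing w with
  | nil => rfl
  | cons b t ih =>
    change φ.app a (M.run t (M.step b w) a) = M'.run t (M'.step b _) a
    rw [ih]
    refine congrFun (congrArg (M'.run t) (funext fun c => ?_)) a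
    rw [step_apply, step_apply, Pi.apply_single (fun c => φ.app c) (fun c => map_zero _), map_sum]
    simp only [φ.comm]

theorem Hom.mapMult_cone {M' : MatrixSystem S} (φ : M.Hom M') (y : FreeGroup S)
    (w : ∀ a, M.V a) : φ.mapMult (M.cone y w) = M'.cone y (fun a => φ.app a (w a)) := by
  ext x a
  simp only [mapMult_apply, cone_apply]
  split_ifs
  · exact run_comm φ _ _ _
  · simp

/-- Inside the radius of multiplicativity, the value at the base point of a cone determines the
function on the whole cone. The bound `n + 1` ensures that the words involved are nonempty and have
a last letter. -/
theorem IsMultFrom.eq_run {n : ℕ} {f : FreeGroup S → ∀ a, M.V a} (hf : M.IsMultFrom (n + 1) f)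
    {y : FreeGroup S} (hy : n + 1 ≤ y.norm) (t : List (S × Bool)) :
    ∀ x : FreeGroup S, x.toWord = y.toWord ++ t → f x = M.run t (f y) := by
  induction t using List.reverseRecOn with
  | nil =>
    intro x hx
    rw [List.append_nil] at hx
    rw [FreeGroup.toWord_injective hx]
    rfl
  | append_singleton t b ih =>
    intro x hx
    rw [← List.append_assoc] at hx
    have h1 := (toWord_mk_of_toWord_eq_append hx).1
    have hx' : x = FreeGroup.mk (y.toWord ++ t) * letter b := by
      rw [letter, FreeGroup.mul_mk, ← hx, FreeGroup.mk_toWord]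
    have hn : n + 1 ≤ (FreeGroup.mk (y.toWord ++ t)).norm := by
      simp only [FreeGroup.norm] at hy ⊢
      rw [h1, List.length_append]
      omega
    have hb : (FreeGroup.mk (y.toWord ++ t) * letter b).norm =
        (FreeGroup.mk (y.toWord ++ t)).norm + 1 := by
      rw [← hx', FreeGroup.norm, FreeGroup.norm, hx, h1, List.length_append,
        List.length_singleton]
    obtain ⟨a, ha⟩ := exists_endsWith (x := FreeGroup.mk (y.toWord ++ t)) (by omega)
    have h := hf _ hn a ha
    rw [hx', h.2 b hb, ← step_of_eq_zero h.1, ih _ h1, run_concat]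

theorem cut_sub_cone_mem_negligible {n : ℕ} {f : M.MultFun} (hf : M.IsMultFrom (n + 1) f.1)
    {y : FreeGroup S} (hy : y.norm = n + 1) :
    M.cut y f - M.cone y (f.1 y) ∈ M.Negligible := by
  -- The two functions agree everywhere, so radius `0` suffices.
  refine mem_negligible_of_norm 0 fun x _ => ?_
  rw [Submodule.coe_sub, Pi.sub_apply, cut_apply, cone_apply]
  split_ifs with h
  · obtain ⟨t, ht⟩ := h
    rw [hf.eq_run hy.ge t x ht.symm, ← ht, FreeGroup.norm, List.drop_left, sub_self]
  · exact sub_self _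

/-- There is no cancellation in `x a`, so translation by `x` maps the cone at `a` onto the cone at
`x a` and keeps the remaining word. Therefore one form on `V a` can serve all the cones whose base
point ends with `a`. -/
theorem translateMult_cone {x : FreeGroup S} {a : S × Bool}
    (ha : (x * letter a).norm = x.norm + 1) (w : ∀ a, M.V a) :
    M.translateMult x (M.cone (letter a) w) = M.cone (x * letter a) w := by
  ext z : 2
  rw [translateMult_apply, cone_apply, cone_apply]
  have key := fun t => toWord_eq_append_iff (z := z) (t := t) ha
  by_cases h : (x * letter a).toWord <+: z.toWord
  · obtain ⟨t, ht⟩ := h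
    rw [if_pos (c := _ <+: z.toWord) ⟨t, ht⟩, if_pos ⟨t, ((key t).1 ht.symm).symm⟩, (key t).1 ht.symm, ← ht,
      FreeGroup.norm, FreeGroup.norm, List.drop_left]
    rfl
  · rw [if_neg h, if_neg]
    rintro ⟨t, ht⟩
    exact h ⟨t, ((key t).2 ht.symm).symm⟩

end Cone

end MatrixSystem

namespace InnerSystem

/-! ### Extension of contractions from multiplicative functions to the Hilbert spaces. -/

section Extension

variable {S : Type*} [Fintype S] [DecidableEq S] (σ : InnerSystem S)

/-- The element of the Hilbert space given by a multiplicative function. -/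
noncomputable def toHilbert : σ.MultFun →ₗ[ℂ] σ.Hilbert :=
  (UniformSpace.Completion.toComplₗᵢ (𝕜 := ℂ) (E := σ.PreHilbert)).toLinearMap ∘ₗ
    σ.toPreHilbert

theorem denseRange_toHilbert : DenseRange σ.toHilbert :=
  UniformSpace.Completion.denseRange_coe.comp σ.toPreHilbert_surjective.denseRange
    (UniformSpace.Completion.continuous_coe _)

variable {σ} in
theorem hilbert_induction {p : σ.Hilbert → Prop} (ξ : σ.Hilbert) (hp : IsClosed {ξ | p ξ})
    (h : ∀ f, p (σ.toHilbert f)) : p ξ :=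
  σ.denseRange_toHilbert.induction_on ξ hp h

theorem inner_toHilbert (f g : σ.MultFun) :
    inner ℂ (σ.toHilbert f) (σ.toHilbert g) = σ.pairing f g :=
  UniformSpace.Completion.inner_coe _ _

theorem norm_sq_toHilbert (f : σ.MultFun) : ‖σ.toHilbert f‖ ^ 2 = (σ.pairing f f).re := by
  rw [← inner_toHilbert, ← inner_self_eq_norm_sq (𝕜 := ℂ)]
  rfl

theorem toHilbert_eq_of_sub_mem {f g : σ.MultFun} (h : f - g ∈ σ.Negligible) :
    σ.toHilbert f = σ.toHilbert g := by
  have : σ.toPreHilbert f = σ.toPreHilbert g := (Submodule.Quotient.eq _).2 h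
  exact congrArg (fun p : σ.PreHilbert => (p : σ.Hilbert)) this

theorem rep_toHilbert (x : FreeGroup S) (f : σ.MultFun) :
    σ.rep x (σ.toHilbert f) = σ.toHilbert (σ.translateMult x f) := σ.rep_coe x f

theorem inner_rep_left (x : FreeGroup S) (ξ η : σ.Hilbert) :
    inner ℂ (σ.rep x ξ) η = inner ℂ ξ (σ.rep x⁻¹ η) := by
  rw [← (σ.rep x).inner_map_map ξ, map_inv]
  congr 1
  exact ((σ.rep x).apply_symm_apply η).symm

variable {σ} {σ' : InnerSystem S}

/-- The linear map on classes of multiplicative functions induced by a linear map on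
multiplicative functions. -/
def preMap (T : σ.MultFun →ₗ[ℂ] σ'.MultFun) (hT : σ.Negligible ≤ σ'.Negligible.comap T) :
    σ.PreHilbert →ₗ[ℂ] σ'.PreHilbert :=
  σ.Negligible.mapQ σ'.Negligible T hT

/-- The continuous extension to the Hilbert spaces of a contraction between spaces of
multiplicative functions. -/
noncomputable def extend (T : σ.MultFun →ₗ[ℂ] σ'.MultFun)
    (hT : σ.Negligible ≤ σ'.Negligible.comap T)
    (hle : ∀ f, (σ'.pairing (T f) (T f)).re ≤ (σ.pairing f f).re) :
    σ.Hilbert →L[ℂ] σ'.Hilbert :=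
  ((preMap T hT).mkContinuous 1 (by
      intro p
      obtain ⟨f, rfl⟩ := σ.toPreHilbert_surjective p
      rw [one_mul]
      refine (sq_le_sq₀ (norm_nonneg _) (norm_nonneg _)).1 ?_
      rw [← inner_self_eq_norm_sq (𝕜 := ℂ), ← inner_self_eq_norm_sq (𝕜 := ℂ)]
      exact hle f)).completion

theorem extend_toHilbert (T : σ.MultFun →ₗ[ℂ] σ'.MultFun)
    (hT : σ.Negligible ≤ σ'.Negligible.comap T)
    (hle : ∀ f, (σ'.pairing (T f) (T f)).re ≤ (σ.pairing f f).re) (f : σ.MultFun) :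
    extend T hT hle (σ.toHilbert f) = σ'.toHilbert (T f) :=
  ContinuousLinearMap.completion_apply_coe _ _

theorem extend_rep {T : σ.MultFun →ₗ[ℂ] σ'.MultFun}
    {hT : σ.Negligible ≤ σ'.Negligible.comap T}
    {hle : ∀ f, (σ'.pairing (T f) (T f)).re ≤ (σ.pairing f f).re} {x : FreeGroup S}
    (hx : ∀ f, T (σ.translateMult x f) = σ'.translateMult x (T f)) (ξ : σ.Hilbert) :
    extend T hT hle (σ.rep x ξ) = σ'.rep x (extend T hT hle ξ) := by
  induction ξ using hilbert_induction with
  | hp => exact isClosed_eq (by fun_prop) (by fun_prop)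
  | h f => rw [rep_toHilbert, extend_toHilbert, extend_toHilbert, hx, rep_toHilbert]

end Extension

/-! ### Restrictions to cones as self-adjoint operators. -/

section Cut

variable {S : Type*} [Fintype S] [DecidableEq S] (σ : InnerSystem S)

/-- Outside the cone the first argument vanishes, so the values of `g` there do not matter.
Symmetrizing this gives self-adjointness in `pairing_cut`. -/
theorem pairing_cut_left (y : FreeGroup S) (f g : σ.MultFun) :
    σ.pairing (σ.cut y f) g = σ.pairing (σ.cut y f) (σ.cut y g) := by
  obtain ⟨N, hf, hg⟩ := σ.exists_isMultFrom f g
  rw [σ.pairing_eq (hf.cut y) (hg.mono (le_max_left _ _)), σ.pairing_eq (hf.cut y) (hg.cut y),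
    level, level]
  refine Finset.sum_congr rfl fun x _ => Finset.sum_congr rfl fun a _ => ?_
  simp only [MatrixSystem.cut_apply]
  split_ifs <;> simp

theorem pairing_cut (y : FreeGroup S) (f g : σ.MultFun) :
    σ.pairing (σ.cut y f) g = σ.pairing f (σ.cut y g) := by
  rw [σ.pairing_cut_left y f g, ← σ.pairing_symm f, σ.pairing_cut_left y g f, σ.pairing_symm]

theorem pairing_cut_le (y : FreeGroup S) (f : σ.MultFun) :
    (σ.pairing (σ.cut y f) (σ.cut y f)).re ≤ (σ.pairing f f).re := by
  obtain ⟨N, hf, -⟩ := σ.exists_isMultFrom f f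
  rw [σ.pairing_eq (hf.cut y) (hf.cut y), σ.pairing_eq (hf.mono (le_max_left N y.norm))
    (hf.mono (le_max_left _ _)), level, level]
  simp only [Complex.re_sum]
  refine Finset.sum_le_sum fun x _ => Finset.sum_le_sum fun a _ => ?_
  simp only [MatrixSystem.cut_apply]
  split_ifs
  · exact le_rfl
  · simpa using σ.B_nonneg _ _

/-- The restriction to the cone of words which begin with `y`, on the Hilbert space. -/
noncomputable def cutCLM (y : FreeGroup S) : σ.Hilbert →L[ℂ] σ.Hilbert :=
  extend (σ.cut y) (MatrixSystem.cut_negligible y) (σ.pairing_cut_le y)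

theorem cutCLM_toHilbert (y : FreeGroup S) (f : σ.MultFun) :
    σ.cutCLM y (σ.toHilbert f) = σ.toHilbert (σ.cut y f) := extend_toHilbert _ _ _ f

theorem inner_cutCLM_left (y : FreeGroup S) (ξ η : σ.Hilbert) :
    inner ℂ (σ.cutCLM y ξ) η = inner ℂ ξ (σ.cutCLM y η) := by
  induction ξ using hilbert_induction with
  | hp => exact isClosed_eq (by fun_prop) (by fun_prop)
  | h f =>
    induction η using hilbert_induction with
    | hp => exact isClosed_eq (by fun_prop) (by fun_prop)
    | h g =>
      rw [cutCLM_toHilbert, cutCLM_toHilbert, inner_toHilbert, inner_toHilbert, pairing_cut]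

end Cut

/-! ### The Hilbert space of an invariant subsystem and the projection onto its complement. -/

section Subsystem

variable {S : Type*}

/-- The restriction of a matrix system to an invariant subsystem. -/
@[reducible] def _root_.MultRep.MatrixSystem.sub (M : MatrixSystem S)
    {W : ∀ a, Submodule ℂ (M.V a)} (hW : M.IsInvariant W) : MatrixSystem S where
  V a := W a
  H b a := (M.H b a).restrict fun v hv => hW a b v hv
  H_eq_zero b a h := by
    ext v
    exact LinearMap.congr_fun (M.H_eq_zero b a h) (v : M.V a)

variable [Fintype S] [DecidableEq S] (σ : InnerSystem S)
  {W : ∀ a, Submodule ℂ (σ.V a)} (hW : σ.IsInvariant W)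

/-- The restriction of a system with inner products to an invariant subsystem. -/
noncomputable def sub : InnerSystem S where
  toMatrixSystem := σ.toMatrixSystem.sub hW
  B a := (σ.B a).domRestrict₁₂ (W a) (W a)
  B_symm a v w := σ.B_symm a v w
  B_nonneg a v := σ.B_nonneg a v
  B_compat a v := σ.B_compat a v

/-- The inclusion of an invariant subsystem. -/
noncomputable def incl : (σ.sub hW).toMatrixSystem.Hom σ.toMatrixSystem where
  app a := (W a).subtype
  comm _ _ _ := rfl

theorem pairing_incl (f : (σ.sub hW).MultFun) :
    σ.pairing ((σ.incl hW).mapMult f) ((σ.incl hW).mapMult f) = (σ.sub hW).pairing f f := by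
  obtain ⟨N, hf, -⟩ := (σ.sub hW).exists_isMultFrom f f
  rw [(σ.sub hW).pairing_eq hf hf, σ.pairing_eq ((σ.incl hW).isMultFrom hf)
    ((σ.incl hW).isMultFrom hf)]
  rfl

/-- The inclusion of the Hilbert space of an invariant subsystem. -/
noncomputable def inclCLM : (σ.sub hW).Hilbert →L[ℂ] σ.Hilbert :=
  extend (σ.incl hW).mapMult (σ.incl hW).mapMult_negligible
    fun f => (congrArg Complex.re (σ.pairing_incl hW f)).le

theorem inclCLM_toHilbert (f : (σ.sub hW).MultFun) :
    σ.inclCLM hW ((σ.sub hW).toHilbert f) = σ.toHilbert ((σ.incl hW).mapMult f) :=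
  extend_toHilbert _ _ _ f

theorem norm_inclCLM (ξ : (σ.sub hW).Hilbert) : ‖σ.inclCLM hW ξ‖ = ‖ξ‖ := by
  induction ξ using hilbert_induction with
  | hp => exact isClosed_eq (by fun_prop) (by fun_prop)
  | h f =>
    rw [← sq_eq_sq₀ (norm_nonneg _) (norm_nonneg _), norm_sq_toHilbert, ← σ.pairing_incl hW,
      inclCLM_toHilbert, norm_sq_toHilbert]

theorem inclCLM_rep (x : FreeGroup S) (ξ : (σ.sub hW).Hilbert) :
    σ.inclCLM hW ((σ.sub hW).rep x ξ) = σ.rep x (σ.inclCLM hW ξ) :=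
  extend_rep ((σ.incl hW).mapMult_translateMult x) ξ

theorem inclCLM_cutCLM (y : FreeGroup S) (ξ : (σ.sub hW).Hilbert) :
    σ.inclCLM hW ((σ.sub hW).cutCLM y ξ) = σ.cutCLM y (σ.inclCLM hW ξ) := by
  induction ξ using hilbert_induction with
  | hp => exact isClosed_eq (by fun_prop) (by fun_prop)
  | h f =>
    rw [cutCLM_toHilbert, inclCLM_toHilbert, inclCLM_toHilbert, cutCLM_toHilbert,
      MatrixSystem.Hom.mapMult_cut]

/-- The isometric embedding of the Hilbert space of an invariant subsystem. -/
noncomputable def inclIsometry : (σ.sub hW).Hilbert →ₗᵢ[ℂ] σ.Hilbert where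
  toLinearMap := (σ.inclCLM hW).toLinearMap
  norm_map' := σ.norm_inclCLM hW

/-- The closed subspace of the Hilbert space given by an invariant subsystem. -/
noncomputable def subRange : Submodule ℂ σ.Hilbert :=
  LinearMap.range (σ.inclIsometry hW).toLinearMap

instance : CompleteSpace (σ.subRange hW) :=
  (σ.inclIsometry hW).isometry.isUniformInducing.isComplete_range.completeSpace_coe

/-- The orthogonal projection onto the complement of the space of an invariant subsystem. -/
noncomputable def complProj : σ.Hilbert →L[ℂ] σ.Hilbert := (σ.subRange hW)ᗮ.starProjection

theorem complProj_mem (ξ : σ.Hilbert) : σ.complProj hW ξ ∈ (σ.subRange hW)ᗮ :=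
  Submodule.starProjection_apply_mem _ _

theorem complProj_of_mem {ξ : σ.Hilbert} (h : ξ ∈ (σ.subRange hW)ᗮ) : σ.complProj hW ξ = ξ :=
  Submodule.starProjection_eq_self_iff.2 h

theorem sub_complProj_mem (ξ : σ.Hilbert) : ξ - σ.complProj hW ξ ∈ σ.subRange hW := by
  have := Submodule.sub_starProjection_mem_orthogonal (K := (σ.subRange hW)ᗮ) ξ
  rwa [Submodule.orthogonal_orthogonal] at this

theorem complProj_of_mem_subRange {ξ : σ.Hilbert} (h : ξ ∈ σ.subRange hW) :
    σ.complProj hW ξ = 0 :=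
  Submodule.starProjection_orthogonal_apply_eq_zero h

variable {σ hW} in
/-- The projection commutes with the operators which leave, together with their adjoints, the
space of the subsystem invariant. -/
theorem complProj_comm {T T' : σ.Hilbert →ₗ[ℂ] σ.Hilbert}
    (hTT' : ∀ ξ η, inner ℂ (T ξ) η = inner ℂ ξ (T' η))
    (hT : ∀ ξ ∈ σ.subRange hW, T ξ ∈ σ.subRange hW)
    (hT' : ∀ ξ ∈ σ.subRange hW, T' ξ ∈ σ.subRange hW) (ξ : σ.Hilbert) :
    σ.complProj hW (T ξ) = T (σ.complProj hW ξ) := by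
  -- Split `ξ` into its component in the range, which `T` keeps there and the projection kills, and
  -- its component in the complement, which `T` keeps there because `T'` preserves the range.
  have h1 : T ξ = T (ξ - σ.complProj hW ξ) + T (σ.complProj hW ξ) := by
    rw [← map_add, sub_add_cancel]
  rw [h1, map_add, complProj_of_mem_subRange _ _ (hT _ (σ.sub_complProj_mem hW ξ)), zero_add]
  apply complProj_of_mem
  rw [Submodule.mem_orthogonal']
  intro η hη
  rw [hTT']
  exact Submodule.inner_left_of_mem_orthogonal (hT' η hη) (σ.complProj_mem hW ξ)

theorem rep_mem_subRange (x : FreeGroup S) {ξ : σ.Hilbert} (h : ξ ∈ σ.subRange hW) :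
    σ.rep x ξ ∈ σ.subRange hW := by
  obtain ⟨η, rfl⟩ := h
  exact ⟨_, σ.inclCLM_rep hW x η⟩

theorem cutCLM_mem_subRange (y : FreeGroup S) {ξ : σ.Hilbert} (h : ξ ∈ σ.subRange hW) :
    σ.cutCLM y ξ ∈ σ.subRange hW := by
  obtain ⟨η, rfl⟩ := h
  exact ⟨_, σ.inclCLM_cutCLM hW y η⟩

theorem complProj_rep (x : FreeGroup S) (ξ : σ.Hilbert) :
    σ.complProj hW (σ.rep x ξ) = σ.rep x (σ.complProj hW ξ) :=
  complProj_comm (T := (σ.rep x).toLinearEquiv.toLinearMap)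
    (T' := (σ.rep x⁻¹).toLinearEquiv.toLinearMap) (σ.inner_rep_left x)
    (fun _ h => σ.rep_mem_subRange hW x h) (fun _ h => σ.rep_mem_subRange hW _ h) ξ

theorem complProj_cutCLM (y : FreeGroup S) (ξ : σ.Hilbert) :
    σ.complProj hW (σ.cutCLM y ξ) = σ.cutCLM y (σ.complProj hW ξ) :=
  complProj_comm (T := (σ.cutCLM y).toLinearMap) (T' := (σ.cutCLM y).toLinearMap)
    (σ.inner_cutCLM_left y)
    (fun _ h => σ.cutCLM_mem_subRange hW y h) (fun _ h => σ.cutCLM_mem_subRange hW y h) ξ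

end Subsystem

end InnerSystem

/-! ### The quotient system and its Hilbert space. -/

namespace InnerSystem

variable {S : Type*} [Fintype S] [DecidableEq S] (σ : InnerSystem S)
  {W : ∀ a, Submodule ℂ (σ.V a)} (hW : σ.IsInvariant W)

/-- The component orthogonal to the subsystem of the multiplicative function which is supported
on the cone of words beginning with `a` and has a given value at `a`. -/
noncomputable def coneCompl (a : S × Bool) : σ.V a →ₗ[ℂ] σ.Hilbert :=
  (σ.complProj hW).toLinearMap ∘ₗ σ.toHilbert ∘ₗ σ.cone (letter a) ∘ₗ LinearMap.single ℂ σ.V a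

theorem coneCompl_apply (a : S × Bool) (v : σ.V a) :
    σ.coneCompl hW a v = σ.complProj hW (σ.toHilbert (σ.cone (letter a) (Pi.single a v))) := rfl

/-- A cone function with value in `W a` is the image of a multiplicative function of the subsystem,
so the projection kills it. Hence `coneCompl` descends to `V a / W a`. -/
theorem le_ker_coneCompl (a : S × Bool) : W a ≤ LinearMap.ker (σ.coneCompl hW a) := by
  intro v hv
  rw [LinearMap.mem_ker, coneCompl_apply]
  refine σ.complProj_of_mem_subRange hW
    ⟨(σ.sub hW).toHilbert ((σ.sub hW).cone (letter a) (Pi.single a ⟨v, hv⟩)), ?_⟩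
  refine (σ.inclCLM_toHilbert hW _).trans ?_
  rw [MatrixSystem.Hom.mapMult_cone]
  congr 2
  funext c
  exact Pi.apply_single (fun c => (σ.incl hW).app c) (fun c => map_zero _) a _ c

/-- Cuts at distinct points of a sphere are self-adjoint with zero product, and they commute with
the projection, so orthogonality of the pieces survives projecting. -/
theorem inner_complProj_cut_of_ne {y z : FreeGroup S} (h : y.norm = z.norm) (hne : y ≠ z)
    (f g : σ.MultFun) : inner ℂ (σ.complProj hW (σ.toHilbert (σ.cut y f)))
      (σ.complProj hW (σ.toHilbert (σ.cut z g))) = 0 := by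
  rw [← MatrixSystem.cut_cut_self y f, ← cutCLM_toHilbert, complProj_cutCLM, inner_cutCLM_left,
    ← complProj_cutCLM, cutCLM_toHilbert, MatrixSystem.cut_cut_of_ne h hne, map_zero, map_zero,
    inner_zero_right]

theorem complProj_cone {x : FreeGroup S} {a : S × Bool}
    (ha : (x * letter a).norm = x.norm + 1) (v : σ.V a) :
    σ.complProj hW (σ.toHilbert (σ.cone (x * letter a) (Pi.single a v))) =
      σ.rep x (σ.coneCompl hW a v) := by
  rw [← MatrixSystem.translateMult_cone ha, ← rep_toHilbert, complProj_rep, coneCompl_apply]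

/-- The central formula: up to a negligible function, `f` is the sum of its cuts along the sphere of
radius `n + 1`. Their projections are mutually orthogonal, and the projected cut at `x a` is the
image under the unitary `rep x` of the vector `coneCompl a` of the value of `f` there. -/
theorem inner_complProj_self {n : ℕ} {f : σ.MultFun} (hf : σ.IsMultFrom (n + 1) f.1) :
    inner ℂ (σ.complProj hW (σ.toHilbert f)) (σ.complProj hW (σ.toHilbert f)) =
      ∑ x ∈ sphere S n, ∑ a with (x * letter a).norm = x.norm + 1,
        inner ℂ (σ.coneCompl hW a (f.1 (x * letter a) a))
          (σ.coneCompl hW a (f.1 (x * letter a) a)) := by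
  have h1 := σ.toHilbert_eq_of_sub_mem (MatrixSystem.sub_sum_cut_mem_negligible f (n + 1))
  have h2 := sum_sphere_succ (fun y => inner ℂ
    (σ.complProj hW (σ.toHilbert (σ.cone y (f.1 y))))
    (σ.complProj hW (σ.toHilbert (σ.cone y (f.1 y))))) n (fun _ => True)
  simp only [and_true, Finset.filter_true] at h2
  rw [h1, map_sum, map_sum, sum_inner]
  trans ∑ y ∈ sphere S (n + 1), inner ℂ
    (σ.complProj hW (σ.toHilbert (σ.cone y (f.1 y))))
    (σ.complProj hW (σ.toHilbert (σ.cone y (f.1 y))))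
  · refine Finset.sum_congr rfl fun y hy => ?_
    have hy' := mem_sphere.1 hy
    rw [inner_sum, Finset.sum_eq_single y,
      σ.toHilbert_eq_of_sub_mem (MatrixSystem.cut_sub_cone_mem_negligible hf hy')]
    · intro z hz hne
      exact σ.inner_complProj_cut_of_ne hW (by rw [hy', mem_sphere.1 hz]) hne.symm f f
    · exact fun h => absurd hy h
  · rw [← h2]
    refine Finset.sum_congr rfl fun x hx => Finset.sum_congr rfl fun a ha => ?_
    rw [mem_sphere] at hx
    simp only [Finset.mem_filter, Finset.mem_univ, true_and] at ha
    -- Since `|x a| = n + 1`, multiplicativity already forces the value at `x a` to be concentrated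
    -- in the component `a`.
    have hs : f.1 (x * letter a) = Pi.single a (f.1 (x * letter a) a) := by
      funext c
      by_cases hc : c = a
      · subst hc
        rw [Pi.single_eq_same]
      · rw [Pi.single_eq_of_ne hc]
        exact (hf _ (by omega) a (endsWith_mul_letter ha)).1 c hc
    rw [hs, complProj_cone σ hW ha, LinearIsometryEquiv.inner_map_map, Pi.single_eq_same]

/-- The left side is the squared norm of the projection of one cone function; evaluating it by
`inner_complProj_self` one sphere further out gives the compatibility condition for the quotient
forms. -/
theorem inner_coneCompl_self (a : S × Bool) (v : σ.V a) :
    inner ℂ (σ.coneCompl hW a v) (σ.coneCompl hW a v) =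
      ∑ b, inner ℂ (σ.coneCompl hW b (σ.H b a v)) (σ.coneCompl hW b (σ.H b a v)) := by
  have hn : (letter a).norm = 1 := rfl
  have hend : EndsWith (letter a) a := rfl
  -- The cone function at `a` is multiplicative from `|a| + 1 = 2`, so `n = 1`; among the words of
  -- length `1` only `x = a` contributes.
  rw [coneCompl_apply, σ.inner_complProj_self hW (n := 1)
    (f := σ.cone (letter a) (Pi.single a v)) (MatrixSystem.isMultFrom_cone (letter a) (Pi.single a v)), Finset.sum_eq_single (letter a),
    Finset.sum_filter]
  · refine Finset.sum_congr rfl fun b _ => ?_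
    split_ifs with hb
    · have hv : (σ.cone (letter a) (Pi.single a v)).1 (letter a * letter b) b = σ.H b a v := by
        rw [MatrixSystem.cone_apply, toWord_mul_letter_of_norm hb,
          if_pos (List.prefix_append _ _), FreeGroup.norm, List.drop_left]
        change σ.step b (Pi.single a v) b = _
        rw [MatrixSystem.step_of_eq_zero (a := a) fun c hc => Pi.single_eq_of_ne hc _,
          Pi.single_eq_same, Pi.single_eq_same]
      rw [hv]
    -- The cancelling letter may be included in the sum because its `H b a` is zero.
    · rw [norm_mul_letter_iff hend, not_not] at hb
      simp [σ.H_eq_zero b a hb]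
  · intro x hx hne
    rw [mem_sphere] at hx
    refine Finset.sum_eq_zero fun b hb => ?_
    simp only [Finset.mem_filter, Finset.mem_univ, true_and] at hb
    have hz : (σ.cone (letter a) (Pi.single a v)).1 (x * letter b) = 0 := by
      rw [MatrixSystem.cone_apply, if_neg]
      rw [prefix_mul_letter_iff hb (by omega), prefix_iff_eq_of_norm_eq (by omega)]
      exact hne.symm
    rw [hz, Pi.zero_apply, map_zero, inner_zero_left]
  · exact fun h => absurd (mem_sphere.2 hn) h

/-- The quotient of a matrix system by an invariant subsystem. -/
@[reducible] def _root_.MultRep.MatrixSystem.quot {S : Type*} (M : MatrixSystem S)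
    {W : ∀ a, Submodule ℂ (M.V a)} (hW : M.IsInvariant W) : MatrixSystem S where
  V a := M.V a ⧸ W a
  H b a := (W a).mapQ (W b) (M.H b a) fun v hv => hW a b v hv
  H_eq_zero b a h := by
    ext v
    exact congrArg (W b).mkQ (LinearMap.congr_fun (M.H_eq_zero b a h) v)

/-- The map induced by `coneCompl` on the quotient. -/
noncomputable def quotCone (a : S × Bool) : (σ.V a ⧸ W a) →ₗ[ℂ] σ.Hilbert :=
  (W a).liftQ (σ.coneCompl hW a) (σ.le_ker_coneCompl hW a)

/-- The quotient of a system with inner products by an invariant subsystem, with the inner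
products given by the distances to the Hilbert space of the subsystem. -/
noncomputable def quot : InnerSystem S where
  toMatrixSystem := σ.toMatrixSystem.quot hW
  B a := LinearMap.mk₂'ₛₗ (starRingEnd ℂ) (RingHom.id ℂ)
    (fun v w => inner ℂ (σ.quotCone hW a v) (σ.quotCone hW a w))
    (fun v v' w => by rw [map_add, inner_add_left])
    (fun r v w => by rw [map_smul, inner_smul_left, smul_eq_mul])
    (fun v w w' => by rw [map_add, inner_add_right])
    (fun r v w => by rw [map_smul, inner_smul_right, RingHom.id_apply, smul_eq_mul])
  B_symm a v w := inner_conj_symm (𝕜 := ℂ) (σ.quotCone hW a w) (σ.quotCone hW a v)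
  B_nonneg a v := inner_self_nonneg (𝕜 := ℂ) (x := σ.quotCone hW a v)
  B_compat a v := by
    obtain ⟨v, rfl⟩ := (W a).mkQ_surjective v
    exact σ.inner_coneCompl_self hW a v

/-- The projection onto the quotient by an invariant subsystem. -/
noncomputable def proj : σ.toMatrixSystem.Hom (σ.quot hW).toMatrixSystem where
  app a := (W a).mkQ
  comm _ _ _ := rfl

theorem pairing_proj (f : σ.MultFun) :
    (σ.quot hW).pairing ((σ.proj hW).mapMult f) ((σ.proj hW).mapMult f) =
      inner ℂ (σ.complProj hW (σ.toHilbert f)) (σ.complProj hW (σ.toHilbert f)) := by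
  obtain ⟨N, hf, -⟩ := σ.exists_isMultFrom f f
  rw [σ.inner_complProj_self hW (hf.mono N.le_succ), (σ.quot hW).pairing_eq
    ((σ.proj hW).isMultFrom hf) ((σ.proj hW).isMultFrom hf)]
  rfl

theorem norm_complProj_le (ξ : σ.Hilbert) : ‖σ.complProj hW ξ‖ ≤ ‖ξ‖ :=
  Submodule.norm_starProjection_apply_le _ _

theorem pairing_proj_le (f : σ.MultFun) :
    ((σ.quot hW).pairing ((σ.proj hW).mapMult f) ((σ.proj hW).mapMult f)).re ≤
      (σ.pairing f f).re := by
  rw [pairing_proj, ← norm_sq_toHilbert]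
  refine (inner_self_eq_norm_sq (𝕜 := ℂ) _).trans_le ?_
  gcongr
  exact σ.norm_complProj_le hW _

/-- The map onto the Hilbert space of the quotient by an invariant subsystem. -/
noncomputable def projCLM : σ.Hilbert →L[ℂ] (σ.quot hW).Hilbert :=
  extend (σ.proj hW).mapMult (σ.proj hW).mapMult_negligible (σ.pairing_proj_le hW)

theorem projCLM_toHilbert (f : σ.MultFun) :
    σ.projCLM hW (σ.toHilbert f) = (σ.quot hW).toHilbert ((σ.proj hW).mapMult f) :=
  extend_toHilbert _ _ _ f

theorem projCLM_rep (x : FreeGroup S) (ξ : σ.Hilbert) :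
    σ.projCLM hW (σ.rep x ξ) = (σ.quot hW).rep x (σ.projCLM hW ξ) :=
  extend_rep ((σ.proj hW).mapMult_translateMult x) ξ

/-- Consequently the kernel of `projCLM` is the space of the subsystem, and `projCLM` is isometric
on the complement. -/
theorem norm_projCLM (ξ : σ.Hilbert) : ‖σ.projCLM hW ξ‖ = ‖σ.complProj hW ξ‖ := by
  induction ξ using hilbert_induction with
  | hp => exact isClosed_eq (by fun_prop) (by fun_prop)
  | h f =>
    rw [← sq_eq_sq₀ (norm_nonneg _) (norm_nonneg _), projCLM_toHilbert, norm_sq_toHilbert,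
      pairing_proj]
    exact inner_self_eq_norm_sq (𝕜 := ℂ) _

theorem projCLM_complProj (ξ : σ.Hilbert) :
    σ.projCLM hW (σ.complProj hW ξ) = σ.projCLM hW ξ := by
  rw [← sub_eq_zero, ← map_sub, ← norm_eq_zero, norm_projCLM, map_sub,
    σ.complProj_of_mem hW (σ.complProj_mem hW ξ), sub_self, norm_zero]

/-- Lifting the values of `f` point by point need not give a multiplicative function. Instead `f` is
replaced, up to a negligible function, by a finite sum of cone functions, and only their values at
the base points are lifted. -/
theorem toHilbert_mem_range_projCLM (f : (σ.quot hW).MultFun) :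
    (σ.quot hW).toHilbert f ∈ LinearMap.range (σ.projCLM hW).toLinearMap := by
  obtain ⟨N, hf, -⟩ := (σ.quot hW).exists_isMultFrom f f
  rw [(σ.quot hW).toHilbert_eq_of_sub_mem
    (MatrixSystem.sub_sum_cut_mem_negligible f (N + 1)), map_sum]
  refine Submodule.sum_mem _ fun y hy => ?_
  rw [(σ.quot hW).toHilbert_eq_of_sub_mem
    (MatrixSystem.cut_sub_cone_mem_negligible (hf.mono N.le_succ) (mem_sphere.1 hy))]
  choose w hw using fun a => (W a).mkQ_surjective (f.1 y a)
  refine ⟨σ.toHilbert (σ.cone y w), (σ.projCLM_toHilbert hW _).trans ?_⟩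
  rw [MatrixSystem.Hom.mapMult_cone]
  exact congrArg (fun w => (σ.quot hW).toHilbert ((σ.quot hW).cone y w)) (funext hw)

/-- The map from the complement of the space of the subsystem to the Hilbert space of the
quotient. -/
noncomputable def complToQuot : (σ.subRange hW)ᗮ →ₗᵢ[ℂ] (σ.quot hW).Hilbert where
  toLinearMap := (σ.projCLM hW).toLinearMap ∘ₗ (σ.subRange hW)ᗮ.subtype
  norm_map' ξ := (σ.norm_projCLM hW ξ).trans (by rw [σ.complProj_of_mem hW ξ.2]; rfl)

/-- The range is closed, being an isometric image of a complete space, and it contains the dense set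
of classes of multiplicative functions. -/
theorem complToQuot_surjective : Function.Surjective (σ.complToQuot hW) := by
  have hc : IsClosed (Set.range (σ.complToQuot hW)) :=
    (σ.complToQuot hW).isometry.isClosedEmbedding.isClosed_range
  intro η
  refine hilbert_induction (p := fun η => η ∈ Set.range (σ.complToQuot hW)) η hc fun f => ?_
  obtain ⟨ξ, hξ⟩ := σ.toHilbert_mem_range_projCLM hW f
  exact ⟨⟨σ.complProj hW ξ, σ.complProj_mem hW ξ⟩, (σ.projCLM_complProj hW ξ).trans hξ⟩

/-- The isometric isomorphism of the complement of the space of the subsystem with the Hilbert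
space of the quotient. -/
noncomputable def complEquivQuot : (σ.subRange hW)ᗮ ≃ₗᵢ[ℂ] (σ.quot hW).Hilbert :=
  LinearIsometryEquiv.ofSurjective (σ.complToQuot hW) (σ.complToQuot_surjective hW)

/-- The isometric embedding of the Hilbert space of the quotient as the complement of the space
of the subsystem. -/
noncomputable def quotIsometry : (σ.quot hW).Hilbert →ₗᵢ[ℂ] σ.Hilbert :=
  (σ.subRange hW)ᗮ.subtypeₗᵢ.comp (σ.complEquivQuot hW).symm.toLinearIsometry

theorem quotIsometry_mem (ξ : (σ.quot hW).Hilbert) :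
    σ.quotIsometry hW ξ ∈ (σ.subRange hW)ᗮ := ((σ.complEquivQuot hW).symm ξ).2

theorem projCLM_quotIsometry (ξ : (σ.quot hW).Hilbert) :
    σ.projCLM hW (σ.quotIsometry hW ξ) = ξ := (σ.complEquivQuot hW).apply_symm_apply ξ

theorem quotIsometry_projCLM {ξ : σ.Hilbert} (h : ξ ∈ (σ.subRange hW)ᗮ) :
    σ.quotIsometry hW (σ.projCLM hW ξ) = ξ :=
  congrArg Subtype.val ((σ.complEquivQuot hW).symm_apply_apply ⟨ξ, h⟩)

theorem range_quotIsometry :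
    LinearMap.range (σ.quotIsometry hW).toLinearMap = (σ.subRange hW)ᗮ := by
  ext ξ
  constructor
  · rintro ⟨η, rfl⟩
    exact σ.quotIsometry_mem hW η
  · exact fun h => ⟨_, σ.quotIsometry_projCLM hW h⟩

/-- On the complement, which is invariant under the representation, this map inverts the equivariant
map `projCLM`. -/
theorem quotIsometry_rep (x : FreeGroup S) (ξ : (σ.quot hW).Hilbert) :
    σ.quotIsometry hW ((σ.quot hW).rep x ξ) = σ.rep x (σ.quotIsometry hW ξ) := by
  conv_lhs => rw [← σ.projCLM_quotIsometry hW ξ, ← projCLM_rep]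
  apply quotIsometry_projCLM
  rw [← σ.complProj_of_mem hW (σ.quotIsometry_mem hW ξ), ← complProj_rep]
  exact σ.complProj_mem hW _

end InnerSystem

namespace InnerSystem

/-! ### The radical of the forms and positive definiteness. -/

section Radical

variable {S : Type*} [Fintype S] (σ : InnerSystem S)

theorem B_self_ofReal (a : S × Bool) (v : σ.V a) : ((σ.B a v v).re : ℂ) = σ.B a v v :=
  Complex.conj_eq_iff_re.1 (σ.B_symm a v v)

/-- By the Cauchy–Schwarz inequality, valid for semi-definite forms, an isotropic vector is
orthogonal to everything. -/
theorem mem_ker_B_iff (a : S × Bool) (v : σ.V a) :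
    v ∈ LinearMap.ker (σ.B a) ↔ σ.B a v v = 0 := by
  refine ⟨fun h => by rw [LinearMap.mem_ker.1 h, LinearMap.zero_apply], fun h => ?_⟩
  let c : PreInnerProductSpace.Core ℂ (σ.V a) :=
    { inner := fun v w => σ.B a v w
      conj_inner_symm := fun v w => σ.B_symm a w v
      re_inner_nonneg := σ.B_nonneg a
      add_left := fun v v' w => by simp
      smul_left := fun v w r => by simp }
  ext w
  have := InnerProductSpace.Core.inner_mul_inner_self_le (c := c) v w
  change ‖σ.B a v w‖ * ‖σ.B a w v‖ ≤ (σ.B a v v).re * (σ.B a w w).re at this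
  rw [h, Complex.zero_re, zero_mul, ← σ.B_symm a v w, Complex.norm_conj] at this
  simpa using mul_self_eq_zero.1 (le_antisymm this (mul_self_nonneg _))

/-- If `B a v v` vanishes, compatibility writes zero as a sum of nonnegative terms, so each term
vanishes. -/
theorem isInvariant_ker_B : σ.IsInvariant fun a => LinearMap.ker (σ.B a) := by
  intro a b v hv
  rw [mem_ker_B_iff] at hv ⊢
  have h := congrArg Complex.re (σ.B_compat a v)
  rw [hv, Complex.zero_re, Complex.re_sum] at h
  have := (Finset.sum_eq_zero_iff_of_nonneg fun b _ => σ.B_nonneg b _).1 h.symm b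
    (Finset.mem_univ b)
  rw [← B_self_ofReal, this, Complex.ofReal_zero]

theorem isPosDef_of_isIrreducible (h : σ.IsIrreducible) (h0 : ∃ a v, σ.B a v v ≠ 0) :
    σ.IsPosDef := by
  intro a v hv
  refine (σ.B_nonneg a v).lt_of_ne fun h1 => ?_
  have h2 : v ∈ LinearMap.ker (σ.B a) := by
    rw [mem_ker_B_iff, ← B_self_ofReal, ← h1, Complex.ofReal_zero]
  rcases h.2 _ σ.isInvariant_ker_B with h3 | h3
  · rw [h3 a] at h2
    exact hv h2
  · obtain ⟨b, w, hw⟩ := h0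
    refine hw ((σ.mem_ker_B_iff b w).1 ?_)
    rw [h3 b]
    trivial

theorem hilbert_eq_zero [DecidableEq S] (h : ∀ a v, σ.B a v v = 0) (ξ : σ.Hilbert) : ξ = 0 := by
  induction ξ using hilbert_induction with
  | hp => exact isClosed_eq continuous_id continuous_const
  | h f =>
    rw [← norm_eq_zero, ← sq_eq_zero_iff, norm_sq_toHilbert, pairing, level]
    simp [h]

end Radical

/-! ### Induction on the total dimension. -/

section Decomposition

variable {S : Type v} [Fintype S] [DecidableEq S] (σ : InnerSystem.{u, v} S)

/-- The representation constructed from the system is an orthogonal direct sum of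
representations constructed from irreducible positive definite systems. -/
def IsDecomposable : Prop :=
  ∃ (ι : Type) (_ : Fintype ι) (τ : ι → InnerSystem.{u, v} S)
    (J : ∀ i, (τ i).Hilbert →ₗᵢ[ℂ] σ.Hilbert),
    (∀ i, (τ i).toMatrixSystem.IsIrreducible ∧ (τ i).IsPosDef) ∧
    (∀ i x ξ, J i ((τ i).rep x ξ) = σ.rep x (J i ξ)) ∧
    (∀ i j, i ≠ j → ∀ ξ η, inner ℂ (J i ξ) (J j η) = 0) ∧
    (⨆ i, LinearMap.range (J i).toLinearMap) = ⊤

variable {σ}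

/-- The Hilbert space is the orthogonal sum of the space of the subsystem and its complement; the
two equivariant isometries carry the given decompositions into these summands. -/
theorem IsDecomposable.of_sub_of_quot {W : ∀ a, Submodule ℂ (σ.V a)} (hW : σ.IsInvariant W)
    (h₁ : (σ.sub hW).IsDecomposable) (h₂ : (σ.quot hW).IsDecomposable) :
    σ.IsDecomposable := by
  obtain ⟨ι₁, _, τ₁, J₁, hτ₁, hJ₁, ho₁, hs₁⟩ := h₁
  obtain ⟨ι₂, _, τ₂, J₂, hτ₂, hJ₂, ho₂, hs₂⟩ := h₂
  have horth : ∀ ξ η, inner ℂ (σ.inclIsometry hW ξ) (σ.quotIsometry hW η) = 0 := fun ξ η =>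
    Submodule.inner_right_of_mem_orthogonal (K := σ.subRange hW) ⟨ξ, rfl⟩
      (σ.quotIsometry_mem hW η)
  refine ⟨ι₁ ⊕ ι₂, inferInstance, Sum.elim τ₁ τ₂, fun i => match i with
    | .inl i => (σ.inclIsometry hW).comp (J₁ i)
    | .inr i => (σ.quotIsometry hW).comp (J₂ i), ?_, ?_, ?_, ?_⟩
  · rintro (i | i)
    · exact hτ₁ i
    · exact hτ₂ i
  · rintro (i | i) x ξ
    · exact (congrArg _ (hJ₁ i x ξ)).trans (σ.inclCLM_rep hW x _)
    · exact (congrArg _ (hJ₂ i x ξ)).trans (σ.quotIsometry_rep hW x _)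
  · rintro (i | i) (j | j) hij ξ η
    · exact ((σ.inclIsometry hW).inner_map_map _ _).trans
        (ho₁ i j (fun h => hij (congrArg _ h)) ξ η)
    · exact horth _ _
    · exact inner_eq_zero_symm.1 (horth _ _)
    · exact ((σ.quotIsometry hW).inner_map_map _ _).trans
        (ho₂ i j (fun h => hij (congrArg _ h)) ξ η)
  · have e₁ : (⨆ i, LinearMap.range ((σ.inclIsometry hW).comp (J₁ i)).toLinearMap) =
        σ.subRange hW := by
      trans (⨆ i, LinearMap.range (J₁ i).toLinearMap).map (σ.inclIsometry hW).toLinearMap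
      · rw [Submodule.map_iSup]
        exact iSup_congr fun i => LinearMap.range_comp _ _
      · rw [hs₁, Submodule.map_top]
        rfl
    have e₂ : (⨆ i, LinearMap.range ((σ.quotIsometry hW).comp (J₂ i)).toLinearMap) =
        (σ.subRange hW)ᗮ := by
      trans (⨆ i, LinearMap.range (J₂ i).toLinearMap).map (σ.quotIsometry hW).toLinearMap
      · rw [Submodule.map_iSup]
        exact iSup_congr fun i => LinearMap.range_comp _ _
      · rw [hs₂, Submodule.map_top, range_quotIsometry]
    rw [iSup_sum]
    exact (congrArg₂ (· ⊔ ·) e₁ e₂).trans Submodule.sup_orthogonal_of_hasOrthogonalProjection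

theorem isDecomposable_of_B_eq_zero (h : ∀ a v, σ.B a v v = 0) : σ.IsDecomposable := by
  refine ⟨Empty, inferInstance, nofun, nofun, nofun, nofun, nofun, ?_⟩
  rw [iSup_of_empty, eq_comm, Submodule.eq_bot_iff]
  exact fun ξ _ => σ.hilbert_eq_zero h ξ

theorem isDecomposable_of_isIrreducible (h : σ.IsIrreducible) (h' : σ.IsPosDef) :
    σ.IsDecomposable := by
  refine ⟨Unit, inferInstance, fun _ => σ, fun _ => LinearIsometry.id, fun _ => ⟨h, h'⟩,
    fun _ _ _ => rfl, fun i j hij => absurd rfl hij, ?_⟩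
  refine Submodule.eq_top_iff'.2 fun ξ => ?_
  exact Submodule.mem_iSup_of_mem () (LinearMap.mem_range.2 ⟨ξ, rfl⟩)

variable (σ) in
theorem isDecomposable : σ.IsDecomposable := by
  induction hn : ∑ a, Module.finrank ℂ (σ.V a) using Nat.strong_induction_on generalizing σ with
  | _ n ih =>
  -- Zero forms are treated before irreducibility is tested, since an irreducible system with zero
  -- forms is not positive definite.
  by_cases h0 : ∀ a v, σ.B a v v = 0
  · exact isDecomposable_of_B_eq_zero h0
  push Not at h0
  by_cases hirr : σ.IsIrreducible
  · exact isDecomposable_of_isIrreducible hirr (σ.isPosDef_of_isIrreducible hirr h0)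
  rw [MatrixSystem.IsIrreducible, not_and] at hirr
  obtain ⟨a, v, hv⟩ := h0
  have hnt : ∃ a, Nontrivial (σ.V a) :=
    ⟨a, nontrivial_of_ne v 0 fun h => hv (by rw [h, map_zero])⟩
  have hirr := hirr hnt
  push Not at hirr
  -- The letters `b`, with `W b` nonzero, and `c`, with `W c` proper, may differ. The dimension of
  -- the subsystem drops at `c`, that of the quotient at `b`.
  obtain ⟨W, hW, ⟨b, hb⟩, c, hc⟩ := hirr
  refine IsDecomposable.of_sub_of_quot hW (ih _ ?_ _ rfl) (ih _ ?_ _ rfl)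
  · rw [← hn]
    exact Finset.sum_lt_sum (fun a _ => Submodule.finrank_le (W a))
      ⟨c, Finset.mem_univ c, Submodule.finrank_lt hc⟩
  · rw [← hn]
    refine Finset.sum_lt_sum (fun a _ => Submodule.finrank_quotient_le (W a))
      ⟨b, Finset.mem_univ b, ?_⟩
    have h1 := Submodule.finrank_quotient_add_finrank (W b)
    have h2 := Submodule.one_le_finrank_iff.2 hb
    change Module.finrank ℂ (σ.V b ⧸ W b) < _
    omega

end Decomposition

end InnerSystem

end MultRep

theorem mainTheorem1 {S : Type v} [Fintype S] [DecidableEq S]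
    (σ : MultRep.InnerSystem.{u, v} S) :
    ∃ (n : ℕ) (τ : Fin n → MultRep.InnerSystem.{u, v} S)
      (K : Fin n → Submodule ℂ σ.Hilbert)
      (U : ∀ i, (τ i).Hilbert ≃ₗᵢ[ℂ] K i),
      (∀ i, (τ i).toMatrixSystem.IsIrreducible ∧ (τ i).IsPosDef) ∧
      (∀ i (x : FreeGroup S) (ξ : (τ i).Hilbert),
        (U i ((τ i).rep x ξ) : σ.Hilbert) = σ.rep x (U i ξ : σ.Hilbert)) ∧
      (∀ i j, i ≠ j → K i ⟂ K j) ∧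
      (⨆ i, K i) = ⊤ := by
  obtain ⟨ι, _, τ, J, hτ, hJ, ho, hs⟩ := σ.isDecomposable
  let e := (Fintype.equivFin ι).symm
  refine ⟨Fintype.card ι, fun i => τ (e i), fun i => LinearMap.range (J (e i)).toLinearMap,
    fun i => (J (e i)).equivRange, fun i => hτ _, fun i x ξ => hJ _ x ξ, fun i j hij => ?_, ?_⟩
  · rw [Submodule.isOrtho_iff_inner_eq]
    rintro _ ⟨ξ, rfl⟩ _ ⟨η, rfl⟩
    exact ho _ _ (e.injective.ne hij) ξ η
  · rw [← hs]
    exact e.iSup_comp (g := fun i => LinearMap.range (J i).toLinearMap)
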